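/- Notation. For $f\in L^2(\mathbb{R})$ (complex valued) let $\widehat f(k)=(2\pi)^{-1/2}\int_{\mathbb{R}}e^{-ikx}f(x)\,dx$ denote its Fourier transform (extended to a unitary operator on $L^2(\mathbb{R})$), let $T_r=e^{ir\partial_x^2}$ be the free Schrödinger evolution, i.e. $\widehat{T_rf}(k)=e^{-irk^2}\widehat f(k)$, and put $$\mathcal{Q}(f_1,f_2,f_3,f_4)=\int_0^1\int_{\mathbb{R}}\overline{T_rf_1(x)}\,T_rf_2(x)\,\overline{T_rf_3(x)}\,T_rf_4(x)\,dx\,dr .$$ For $\omega\in\mathbb{R}$, a function $f\in L^2(\mathbb{R})$ is called a weak solution of $\omega f=Q(f,f,f)$, where $Q(f,f,f)=\int_0^1T_r^{-1}\bigl[|T_rf|^2\,T_rf\bigr]dr$, if $$\omega\int_{\mathbb{R}}\overline{g(x)}f(x)\,dx=\mathcal{Q}(g,f,f,f)\qquad\text{for all }g\in L^2(\mathbb{R}).$$ The tails of $f$ and of $\widehat f$ are $$\alpha(s)=\Bigl(\int_{|x|\ge s}|f(x)|^2\,dx\Bigr)^{1/2},\qquad \beta(s)=\Bigl(\int_{|k|\ge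 s}|\widehat f(k)|^2\,dk\Bigr)^{1/2}.$$ Theorem. Let $\omega\in\mathbb{R}$ and let $f\in L^2(\mathbb{R})$ be a weak solution of $\omega f=Q(f,f,f)$. Then there exist $s_0>0$ and $\widehat s_0>0$ such that $$\alpha(s)\le\alpha(s_0)\,3^{1/4}\,3^{-\left(\log_3\frac{s}{3s_0}\right)^2/4}\quad\text{for all }s\ge s_0,$$ $$\beta(s)\le\beta(\widehat s_0)\,3^{1/4}\,3^{-\left(\log_3\frac{s}{3\widehat s_0}\right)^2/4}\quad\text{for all }s\ge\widehat s_0.$$ In particular, for every $\gamma>0$ there is a finite constant $C_\gamma$ such that $\alpha(s)\le C_\gamma s^{-\gamma}$ and $\beta(s)\le C_\gamma s^{-\gamma}$ for all $s>0$. -/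

import Mathlib

noncomputable section

open MeasureTheory Real
open scoped FourierTransform ENNReal

namespace DispersionManagement

/-- The Hilbert space `L²(ℝ)` of complex valued functions (with Lebesgue measure). -/
abbrev L2 : Type := Lp ℂ 2 (volume : Measure ℝ)

/-- The symbol of the free Schroedinger group `e^{ir∂ₓ²}` in the frequency variable `ξ` of
Mathlib's Fourier transform, `∂ₓ ↔ 2πiξ`, that is `e^{-irη²}` with `η = 2πξ`. -/
def schrodingerSymbol (r ξ : ℝ) : ℂ :=
  Complex.exp (-(Complex.I * (r : ℂ) * ((2 * π * ξ : ℝ) : ℂ) ^ 2))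

theorem norm_schrodingerSymbol (r ξ : ℝ) : ‖schrodingerSymbol r ξ‖ = 1 := by
  have h : -(Complex.I * (r : ℂ) * ((2 * π * ξ : ℝ) : ℂ) ^ 2)
      = ((-(r * (2 * π * ξ) ^ 2) : ℝ) : ℂ) * Complex.I := by
    push_cast
    ring
  rw [schrodingerSymbol, h, Complex.norm_exp_ofReal_mul_I]

theorem continuous_schrodingerSymbol (r : ℝ) : Continuous (schrodingerSymbol r) := by
  unfold schrodingerSymbol
  fun_prop

theorem memLp_schrodingerSymbol_mul (r : ℝ) (h : L2) :
    MemLp (fun ξ => schrodingerSymbol r ξ * h ξ) 2 (volume : Measure ℝ) := by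
  refine (Lp.memLp h).of_le
    ((continuous_schrodingerSymbol r).aestronglyMeasurable.mul (Lp.aestronglyMeasurable h)) ?_
  exact Filter.Eventually.of_forall fun ξ => by simp [norm_schrodingerSymbol]

/-- The free Schroedinger evolution `T_r = e^{ir∂ₓ²}` on `L²(ℝ)`, as a Fourier multiplier. -/
def T (r : ℝ) (f : L2) : L2 :=
  𝓕⁻ ((memLp_schrodingerSymbol_mul r (𝓕 f)).toLp
    (fun ξ => schrodingerSymbol r ξ * (𝓕 f : L2) ξ) : L2)

/-- The four-linear functional
`𝒬(f₁,f₂,f₃,f₄) = ∫₀¹ ∫ conj(T_r f₁) (T_r f₂) conj(T_r f₃) (T_r f₄) dx dr`. -/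
def Q4 (f₁ f₂ f₃ f₄ : L2) : ℂ :=
  ∫ r in (0 : ℝ)..1, ∫ x : ℝ,
    (starRingEnd ℂ) (T r f₁ x) * T r f₂ x * (starRingEnd ℂ) (T r f₃ x) * T r f₄ x

/-- `f ∈ L²(ℝ)` is a weak solution of `ω f = Q(f,f,f)`: `ω ⟨g, f⟩ = 𝒬(g,f,f,f)` for all
`g ∈ L²(ℝ)`. The scalar product is conjugate linear in its first argument. -/
def IsWeakSolution (ω : ℝ) (f : L2) : Prop :=
  ∀ g : L2, (ω : ℂ) * inner ℂ g f = Q4 g f f f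

/-- The unitary Fourier transform `f̂(k) = (2π)^{-1/2} ∫ e^{-ikx} f(x) dx` on `L²(ℝ)`: Mathlib's
transform has the kernel `e^{-2πixξ}`, hence `f̂(k) = (2π)^{-1/2} (𝓕 f)(k / 2π)`. -/
def unitaryFourier (f : L2) (k : ℝ) : ℂ :=
  (((√(2 * π))⁻¹ : ℝ) : ℂ) * (𝓕 f : L2) (k / (2 * π))

/-- The tail `(∫_{|x| ≥ s} |h(x)|² dx)^{1/2}` of a function `h`. -/
def l2Tail (h : ℝ → ℂ) (s : ℝ) : ℝ :=
  √(∫ x in {x : ℝ | s ≤ |x|}, ‖h x‖ ^ 2)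

/-- The tail `α` of `f`. -/
def tailα (f : L2) (s : ℝ) : ℝ := l2Tail f s

/-- The tail `β` of the Fourier transform of `f`. -/
def tailβ (f : L2) (s : ℝ) : ℝ := l2Tail (unitaryFourier f) s

end DispersionManagement

end

noncomputable section

open MeasureTheory Real Filter Topology
open scoped FourierTransform ENNReal

namespace DispersionManagement

/-! Test the equation with the part of `f` in `|x| ≥ 3s`. The left side becomes `ω α(3s)²`, so
everything rests on bounding `𝒬(g,f,f,f)` when `g` lives far out. The same is done for the Fourier
transform of `f`.

Both sides use one majorant, `absForm`: the integral of `kern |ab|` against the moduli of the four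
functions at `y`, `y+a`, `y+a+b`, `y+b`. On the Fourier side, Plancherel turns the `x`-integral into
an integral over such quadruples, where the quadratic phases add up to a multiple of `r·ab`;
averaging over `r` gives decay in `|ab|`. On the physical side, `T_r` is a chirp times a rescaled
inverse Fourier transform of a chirped function, so the same computation applies with time `1/(4r)`
and density `1/(4πr)`. The resulting oscillatory integral has a logarithmic singularity at `ab = 0`
and decays like `1/|ab|`. In both cases `kern` dominates (`enorm_Q4_le_fourier`,
`enorm_Q4_le_physical`).

The majorant is bounded on `L²` (`absForm_le`), and restricting it to `max(|a|,|b|) ≥ s` gains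
`s^{-1/2}` (`lintegral_separated_le`). If `|y| ≥ 3s`, either all other points have modulus at least
`s`, or some separation is at least `s` and at least one other point still has modulus at least `s`
(`resProd_cut_le`). Hence, for `ω ≠ 0`, `t(3s) ≤ C t(s) (t(s)² + s^{-1/2})` for each tail `t`. Each
step along `s₀ 3ⁿ` gains a further factor `3^{-n/2}`, and these multiply to `3^{-n²/4}`
(`tail_decay_of_recursion`). If `ω = 0`, then `𝒬(f,f,f,f) = 0` forces `f = 0`.

The estimates are proved for bounded integrable data and extended by density. Continuity of `Q4` on
`L²` comes from an `L⁴` space-time bound, itself the diagonal case of the quadrilinear estimate. -/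

/-! ### Fourier integrals and the `L²` Fourier transform -/

/-- An `L²` function is determined by its pairings with Schwartz functions. -/
theorem ae_eq_of_forall_schwartz {H : L2} {G : ℝ → ℂ} (hG : Continuous G)
    (hpair : ∀ φ : SchwartzMap ℝ ℂ, ∫ x, φ x • H x = ∫ x, φ x • G x) :
    (H : ℝ → ℂ) =ᵐ[volume] G := by
  have hloc : LocallyIntegrable (fun x => H x - G x) volume :=
    ((Lp.memLp _).locallyIntegrable (by norm_num)).sub hG.locallyIntegrable
  have key := ae_eq_zero_of_integral_contDiff_smul_eq_zero hloc ?_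
  · filter_upwards [key] with x hx
    exact sub_eq_zero.mp hx
  intro g hg hgs
  have hgc : HasCompactSupport (fun x => (g x : ℂ)) := hgs.comp_left (g := ((↑) : ℝ → ℂ)) rfl
  set φ : SchwartzMap ℝ ℂ := hgc.toSchwartzMap (Complex.ofRealCLM.contDiff.comp hg) with hφ
  have hφv : ∀ x, φ x = (g x : ℂ) := fun x => rfl
  have i1 : Integrable (fun x => φ x • H x) :=
    memLp_one_iff_integrable.1 ((Lp.memLp H).smul (φ.memLp 2 volume))
  have i2 : Integrable (fun x => φ x • G x) :=
    (φ.continuous.smul hG).integrable_of_hasCompactSupport (HasCompactSupport.smul_right hgc)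
  have : ∀ x, g x • (H x - G x) = φ x • H x - φ x • G x := by
    intro x
    rw [hφv, ← smul_sub, Complex.real_smul, smul_eq_mul]
  simp_rw [this]
  rw [integral_sub i1 i2, hpair, sub_self]

theorem continuous_fourier_of_integrable {h : ℝ → ℂ} (h1 : Integrable h) : Continuous (𝓕 h) :=
  VectorFourier.fourierIntegral_continuous (L := (innerₗ ℝ)) (μ := volume)
    Real.continuous_fourierChar (by exact continuous_inner) h1

theorem continuous_fourierInv_of_integrable {h : ℝ → ℂ} (h1 : Integrable h) :
    Continuous (𝓕⁻ h) := by
  have h' : 𝓕⁻ h = fun x => 𝓕 h (-x) := by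
    ext x; exact Real.fourierInv_eq_fourier_neg h x
  rw [h']
  exact (continuous_fourier_of_integrable h1).comp continuous_neg

/-- On `L¹ ∩ L²` the inverse Fourier transform of `L²` is the Fourier integral. -/
theorem fourierInv_toLp_ae_eq {h : ℝ → ℂ} (h1 : Integrable h) (h2 : MemLp h 2 volume) :
    ((𝓕⁻ (h2.toLp h) : L2) : ℝ → ℂ) =ᵐ[volume] 𝓕⁻ h := by
  refine ae_eq_of_forall_schwartz (continuous_fourierInv_of_integrable h1) fun φ => ?_
  have e1 : ∫ x, φ x • (𝓕⁻ (h2.toLp h) : L2) x = ∫ x, (𝓕⁻ φ) x • (h2.toLp h) x := by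
    have := congrArg (fun d => d φ) (Lp.fourierInv_toTemperedDistribution_eq (h2.toLp h))
    simpa [TemperedDistribution.fourierInv_apply, Lp.toTemperedDistribution_apply] using this.symm
  have e2 : ∫ x, (𝓕⁻ φ) x • (h2.toLp h) x = ∫ x, (𝓕⁻ (φ : ℝ → ℂ)) x • h x := by
    apply integral_congr_ae
    filter_upwards [h2.coeFn_toLp] with x hx
    rw [hx, SchwartzMap.fourierInv_coe]
  -- The inverse transform is the Fourier integral of the bilinear form `-⟨·,·⟩`, so the
  -- multiplication formula covers it too.
  have e3 := VectorFourier.integral_fourierIntegral_smul_eq_flip (L := -(innerₗ ℝ)) (μ := volume)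
      (ν := volume) (f := (φ : ℝ → ℂ)) (g := h) Real.continuous_fourierChar
      (by exact continuous_inner.neg) φ.integrable h1
  have hflip : (-(innerₗ ℝ)).flip = -(innerₗ ℝ) := by
    ext; simp
  rw [hflip] at e3
  rw [e1, e2]
  exact e3

/-- On `L¹ ∩ L²` the Fourier transform of `L²` is the Fourier integral. -/
theorem fourier_toLp_ae_eq {h : ℝ → ℂ} (h1 : Integrable h) (h2 : MemLp h 2 volume) :
    ((𝓕 (h2.toLp h) : L2) : ℝ → ℂ) =ᵐ[volume] 𝓕 h := by
  refine ae_eq_of_forall_schwartz (continuous_fourier_of_integrable h1) fun φ => ?_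
  have e1 : ∫ x, φ x • (𝓕 (h2.toLp h) : L2) x = ∫ x, (𝓕 φ) x • (h2.toLp h) x := by
    have := congrArg (fun d => d φ) (Lp.fourier_toTemperedDistribution_eq (h2.toLp h))
    simpa [TemperedDistribution.fourier_apply, Lp.toTemperedDistribution_apply] using this.symm
  have e2 : ∫ x, (𝓕 φ) x • (h2.toLp h) x = ∫ x, (𝓕 (φ : ℝ → ℂ)) x • h x := by
    apply integral_congr_ae
    filter_upwards [h2.coeFn_toLp] with x hx
    rw [hx, SchwartzMap.fourier_coe]
  have e3 := VectorFourier.integral_fourierIntegral_smul_eq_flip (L := innerₗ ℝ) (μ := volume)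
      (ν := volume) (f := (φ : ℝ → ℂ)) (g := h) Real.continuous_fourierChar
      (by exact continuous_inner) φ.integrable h1
  rw [flip_innerₗ] at e3
  rw [e1, e2]
  exact e3

/-- Dominated convergence in `L²`. -/
theorem tendsto_eLpNorm_two_of_dominated {g : ℕ → ℝ → ℂ} {G : ℝ → ℂ} {b : ℝ → ℂ}
    (hg : ∀ n, AEStronglyMeasurable (g n) volume) (hG : AEStronglyMeasurable G volume)
    (hb : MemLp b 2 volume)
    (hle : ∀ n, ∀ᵐ x, ‖g n x - G x‖ ≤ ‖b x‖)
    (hlim : ∀ᵐ x, Tendsto (fun n => g n x) atTop (𝓝 (G x))) :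
    Tendsto (fun n => eLpNorm (g n - G) 2 volume) atTop (𝓝 0) := by
  have h0 : Tendsto (fun n => ∫⁻ x, ‖g n x - G x‖ₑ ^ (2:ℝ)) atTop (𝓝 (∫⁻ _ : ℝ, 0)) := by
    apply tendsto_lintegral_of_dominated_convergence' (fun x => ‖b x‖ₑ ^ (2:ℝ))
    · intro n; exact ((hg n).sub hG).enorm.pow_const _
    · intro n
      filter_upwards [hle n] with x hx
      gcongr
      exact enorm_le_iff_norm_le.2 hx
    · have := hb.eLpNorm_lt_top
      rw [eLpNorm_lt_top_iff_lintegral_rpow_enorm_lt_top (by norm_num) (by norm_num)] at this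
      simpa using this.ne
    · filter_upwards [hlim] with x hx
      have : Tendsto (fun n => ‖g n x - G x‖ₑ ^ (2:ℝ)) atTop (𝓝 (‖G x - G x‖ₑ ^ (2:ℝ))) :=
        ((hx.sub_const _).enorm).ennrpow_const _
      simpa using this
  simp only [lintegral_zero] at h0
  have h1 : Tendsto (fun n => (∫⁻ x, ‖g n x - G x‖ₑ ^ (2:ℝ)) ^ (1/2:ℝ)) atTop (𝓝 (0 ^ (1/2:ℝ))) :=
    h0.ennrpow_const _
  rw [ENNReal.zero_rpow_of_pos (by norm_num)] at h1
  refine h1.congr fun n => ?_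
  rw [eLpNorm_eq_lintegral_rpow_enorm_toReal (by norm_num) (by norm_num)]
  simp

/-! ### Plancherel for four functions -/

/-- Bounded, measurable, integrable functions on the line. -/
structure Nice (h : ℝ → ℂ) : Prop where
  measurable : Measurable h
  integrable : Integrable h
  bounded : ∃ M, ∀ x, ‖h x‖ ≤ M

theorem Nice.memLp {h : ℝ → ℂ} (hh : Nice h) : MemLp h 2 volume := by
  obtain ⟨M, hM⟩ := hh.bounded
  rw [memLp_two_iff_integrable_sq_norm hh.integrable.aestronglyMeasurable]
  simp_rw [pow_two]
  exact hh.integrable.norm.bdd_mul (c := M) hh.integrable.norm.aestronglyMeasurable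
    (Eventually.of_forall fun x => by simpa using hM x)

theorem Nice.mul {h p : ℝ → ℂ} (hh : Nice h) (hp : Measurable p) (hp1 : ∀ x, ‖p x‖ ≤ 1) :
    Nice (fun x => p x * h x) := by
  obtain ⟨M, hM⟩ := hh.bounded
  refine ⟨hp.mul hh.measurable, hh.integrable.bdd_mul hp.aestronglyMeasurable
    (Eventually.of_forall hp1), M, fun x => ?_⟩
  rw [norm_mul]
  calc ‖p x‖ * ‖h x‖ ≤ 1 * ‖h x‖ := by gcongr; exact hp1 x
    _ ≤ M := by simpa using hM x

theorem Nice.sub {h p : ℝ → ℂ} (hh : Nice h) (hp : Nice p) : Nice (fun x => h x - p x) := by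
  obtain ⟨M, hM⟩ := hh.bounded
  obtain ⟨N, hN⟩ := hp.bounded
  exact ⟨hh.measurable.sub hp.measurable, hh.integrable.sub hp.integrable, M + N,
    fun x => (norm_sub_le _ _).trans (add_le_add (hM x) (hN x))⟩

theorem fourierInv_real_eq (h : ℝ → ℂ) (x : ℝ) :
    𝓕⁻ h x = ∫ y : ℝ, Complex.exp (2 * π * x * y * Complex.I) * h y := by
  rw [Real.fourierInv_eq']
  apply integral_congr_ae
  filter_upwards with y
  simp [mul_assoc]

theorem lintegral_const_mul_add_left {f : ℝ → ℝ≥0∞} (hf : Measurable f) (c : ℝ≥0∞) (y : ℝ) :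
    ∫⁻ b, c * f (y + b) = c * ∫⁻ b, f b := by
  have hm : Measurable (fun b => f (y + b)) := hf.comp (measurable_const_add y)
  rw [lintegral_const_mul c hm, lintegral_add_left_eq_self f y]

/-- The correlation `c ↦ ∫ conj(g₁(y)) g₂(y + c) dy`. -/
def corr (g₁ g₂ : ℝ → ℂ) (c : ℝ) : ℂ := ∫ y, (starRingEnd ℂ) (g₁ y) * g₂ (y + c)

/-- The shear `(y, c) ↦ (y, y + c)` preserves Lebesgue measure and turns the integrand into a tensor
product. -/
theorem integrable_corr_integrand {g₁ g₂ : ℝ → ℂ} (h₁ : Nice g₁) (h₂ : Nice g₂) :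
    Integrable (fun p : ℝ × ℝ => (starRingEnd ℂ) (g₁ p.1) * g₂ (p.1 + p.2)) := by
  have hc : Integrable (fun y => (starRingEnd ℂ) (g₁ y)) :=
    (LinearIsometryEquiv.integrable_comp_iff Complex.conjLIE).2 h₁.integrable
  exact (measurePreserving_prod_add (volume : Measure ℝ) (volume : Measure ℝ)).integrable_comp_of_integrable
    (hc.mul_prod h₂.integrable)

theorem Nice.corr {g₁ g₂ : ℝ → ℂ} (h₁ : Nice g₁) (h₂ : Nice g₂) : Nice (corr g₁ g₂) := by
  obtain ⟨M, hM⟩ := h₂.bounded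
  refine ⟨?_, (integrable_corr_integrand h₁ h₂).integral_prod_right, M * ∫ y, ‖g₁ y‖, fun c => ?_⟩
  · have hm : Measurable (fun p : ℝ × ℝ => (starRingEnd ℂ) (g₁ p.2) * g₂ (p.2 + p.1)) :=
      (Complex.continuous_conj.measurable.comp (h₁.measurable.comp measurable_snd)).mul
        (h₂.measurable.comp (measurable_snd.add measurable_fst))
    exact (hm.stronglyMeasurable.integral_prod_right (ν := volume)).measurable
  · rw [DispersionManagement.corr, ← integral_const_mul]
    apply norm_integral_le_of_norm_le (h₁.integrable.norm.const_mul M)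
    filter_upwards with y
    rw [norm_mul, RCLike.norm_conj, mul_comm]
    gcongr
    exact hM _

/-- Fubini and the substitution `z = y + c` separate the double integral, the exponential splitting
accordingly. -/
theorem fourierInv_corr {g₁ g₂ : ℝ → ℂ} (h₁ : Nice g₁) (h₂ : Nice g₂) (x : ℝ) :
    𝓕⁻ (corr g₁ g₂) x = (starRingEnd ℂ) (𝓕⁻ g₁ x) * 𝓕⁻ g₂ x := by
  have hi : Integrable (Function.uncurry fun c y : ℝ => Complex.exp (2 * π * x * c * Complex.I) *
      ((starRingEnd ℂ) (g₁ y) * g₂ (y + c))) := by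
    refine (integrable_corr_integrand h₁ h₂).swap.bdd_mul (c := 1) (by fun_prop)
      (Eventually.of_forall fun p => ?_)
    rw [show (2 * π * x * p.1 * Complex.I : ℂ) = ((2 * π * x * p.1 : ℝ) : ℂ) * Complex.I by
      push_cast; ring, Complex.norm_exp_ofReal_mul_I]
  rw [fourierInv_real_eq]
  simp_rw [corr, ← integral_const_mul]
  rw [integral_integral_swap hi, fourierInv_real_eq g₁, ← integral_conj, ← integral_mul_const]
  apply integral_congr_ae
  filter_upwards with y
  rw [fourierInv_real_eq g₂,
    ← integral_add_left_eq_self (fun z : ℝ => Complex.exp (2 * π * x * z * Complex.I) * g₂ z) y, ← integral_const_mul]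
  apply integral_congr_ae
  filter_upwards with c
  rw [map_mul, ← Complex.exp_conj]
  simp only [map_mul, Complex.conj_ofReal, Complex.conj_I, map_ofNat]
  have : Complex.exp (2 * π * x * c * Complex.I) = Complex.exp (2 * π * x * y * -Complex.I) *
     Complex.exp (2 * π * x * ((y + c : ℝ) : ℂ) * Complex.I) := by
    rw [← Complex.exp_add]; congr 1; push_cast; ring
  rw [this]; ring

theorem integral_conj_fourierInv_mul {u v : ℝ → ℂ} (hu : Nice u) (hv : Nice v) :
    ∫ x, (starRingEnd ℂ) (𝓕⁻ u x) * 𝓕⁻ v x = ∫ x, (starRingEnd ℂ) (u x) * v x := by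
  have h1 : inner ℂ (𝓕⁻ (hu.memLp.toLp u) : L2) (𝓕⁻ (hv.memLp.toLp v) : L2) =
      inner ℂ (hu.memLp.toLp u) (hv.memLp.toLp v) :=
    (Lp.fourierTransformₗᵢ ℝ ℂ).symm.inner_map_map _ _
  rw [L2.inner_def, L2.inner_def] at h1
  refine Eq.trans ?_ (h1.trans ?_)
  · apply integral_congr_ae
    filter_upwards [fourierInv_toLp_ae_eq hu.integrable hu.memLp,
      fourierInv_toLp_ae_eq hv.integrable hv.memLp] with x hx hy
    rw [hx, hy, RCLike.inner_apply, mul_comm]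
  · apply integral_congr_ae
    filter_upwards [hu.memLp.coeFn_toLp, hv.memLp.coeFn_toLp] with x hx hy
    rw [hx, hy, RCLike.inner_apply, mul_comm]

/-- The resonant product `conj(h₁(y)) h₂(y+a) conj(h₃(y+a+b)) h₄(y+b)` at `(a, (y, b))`. -/
def resonant (h₁ h₂ h₃ h₄ : ℝ → ℂ) (p : ℝ × ℝ × ℝ) : ℂ :=
  (starRingEnd ℂ) (h₁ p.2.1) * h₂ (p.2.1 + p.1) *
    ((starRingEnd ℂ) (h₃ (p.2.1 + p.1 + p.2.2)) * h₄ (p.2.1 + p.2.2))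

theorem measurable_resonant {h₁ h₂ h₃ h₄ : ℝ → ℂ} (m₁ : Measurable h₁) (m₂ : Measurable h₂)
    (m₃ : Measurable h₃) (m₄ : Measurable h₄) : Measurable (resonant h₁ h₂ h₃ h₄) := by
  unfold resonant
  have hc := Complex.continuous_conj.measurable
  exact ((hc.comp (m₁.comp (by fun_prop))).mul (m₂.comp (by fun_prop))).mul
    ((hc.comp (m₃.comp (by fun_prop))).mul (m₄.comp (by fun_prop)))

/-- Once `h₃` is replaced by its supremum, the remaining arguments `y`, `y+a`, `y+b` are independent
coordinates and the integral factorises into `L¹` norms. -/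
theorem integrable_resonant {h₁ h₂ h₃ h₄ : ℝ → ℂ} (n₁ : Nice h₁) (n₂ : Nice h₂) (n₃ : Nice h₃)
    (n₄ : Nice h₄) : Integrable (resonant h₁ h₂ h₃ h₄) := by
  have hm := measurable_resonant n₁.measurable n₂.measurable n₃.measurable n₄.measurable
  obtain ⟨M, hM⟩ := n₃.bounded
  have hmeas : Measurable fun p : ℝ × ℝ × ℝ =>
      ‖h₁ p.2.1‖ₑ * ‖h₂ (p.2.1 + p.1)‖ₑ * ‖h₄ (p.2.1 + p.2.2)‖ₑ :=
    ((n₁.measurable.comp (by fun_prop)).enorm.mul (n₂.measurable.comp (by fun_prop)).enorm).mul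
      (n₄.measurable.comp (by fun_prop)).enorm
  refine ⟨hm.aestronglyMeasurable, ?_⟩
  calc ∫⁻ p, ‖resonant h₁ h₂ h₃ h₄ p‖ₑ
      ≤ ∫⁻ p : ℝ × ℝ × ℝ, ENNReal.ofReal M *
        (‖h₁ p.2.1‖ₑ * ‖h₂ (p.2.1 + p.1)‖ₑ * ‖h₄ (p.2.1 + p.2.2)‖ₑ) := by
        apply lintegral_mono
        intro p
        simp only [resonant, enorm_mul, RCLike.enorm_conj]
        rw [mul_comm ‖h₃ _‖ₑ, ← mul_assoc, mul_comm (ENNReal.ofReal M)]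
        gcongr
        rw [← ofReal_norm]
        exact ENNReal.ofReal_le_ofReal (hM _)
    _ = ENNReal.ofReal M * ∫⁻ a, ∫⁻ y, ∫⁻ b, ‖h₁ y‖ₑ * ‖h₂ (y + a)‖ₑ * ‖h₄ (y + b)‖ₑ := by
        rw [lintegral_const_mul _ hmeas, Measure.volume_eq_prod, lintegral_prod _ hmeas.aemeasurable]
        congr 2
        ext a
        rw [Measure.volume_eq_prod, lintegral_prod]
        exact (hmeas.comp (measurable_const.prodMk measurable_id)).aemeasurable
    _ = ENNReal.ofReal M * ((∫⁻ y, ‖h₁ y‖ₑ) * (∫⁻ y, ‖h₂ y‖ₑ) * (∫⁻ y, ‖h₄ y‖ₑ)) := by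
        congr 1
        have e : ∀ a y : ℝ, ∫⁻ b, ‖h₁ y‖ₑ * ‖h₂ (y + a)‖ₑ * ‖h₄ (y + b)‖ₑ =
            (‖h₁ y‖ₑ * ∫⁻ y, ‖h₄ y‖ₑ) * ‖h₂ (y + a)‖ₑ := by
          intro a y
          rw [lintegral_const_mul_add_left n₄.measurable.enorm]
          ring
        simp_rw [e]
        rw [lintegral_lintegral_swap]
        · have e2 : ∀ y : ℝ, ∫⁻ a, (‖h₁ y‖ₑ * ∫⁻ y, ‖h₄ y‖ₑ) * ‖h₂ (y + a)‖ₑ =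
              ‖h₁ y‖ₑ * ((∫⁻ y, ‖h₄ y‖ₑ) * ∫⁻ y, ‖h₂ y‖ₑ) := by
            intro y
            rw [lintegral_const_mul_add_left n₂.measurable.enorm, mul_assoc]
          simp_rw [e2]
          rw [lintegral_mul_const _ n₁.measurable.enorm]
          ring
        · exact (((n₁.measurable.comp (by fun_prop)).enorm.mul_const _).mul
            (n₂.measurable.comp (by fun_prop)).enorm).aemeasurable
    _ < ⊤ := by
        refine ENNReal.mul_lt_top ENNReal.ofReal_lt_top (ENNReal.mul_lt_top (ENNReal.mul_lt_top ?_ ?_) ?_)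
        · exact n₁.integrable.2
        · exact n₂.integrable.2
        · exact n₄.integrable.2

/-- Four functions: the physical side integral is the resonant integral on the other side. -/
theorem integral_fourierInv_four {g₁ g₂ g₃ g₄ : ℝ → ℂ} (n₁ : Nice g₁) (n₂ : Nice g₂)
    (n₃ : Nice g₃) (n₄ : Nice g₄) :
    ∫ x, (starRingEnd ℂ) (𝓕⁻ g₁ x) * 𝓕⁻ g₂ x * (starRingEnd ℂ) (𝓕⁻ g₃ x) * 𝓕⁻ g₄ x
      = ∫ p, resonant g₁ g₂ g₃ g₄ p := by
  -- The four factors are grouped as (1,2) and (3,4); each pair is the transform of a correlation,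
  -- the second one conjugated, so Parseval applies.
  have h := integral_conj_fourierInv_mul (n₄.corr n₃) (n₁.corr n₂)
  have e1 : ∀ x, (starRingEnd ℂ) (𝓕⁻ g₁ x) * 𝓕⁻ g₂ x * (starRingEnd ℂ) (𝓕⁻ g₃ x) * 𝓕⁻ g₄ x =
      (starRingEnd ℂ) (𝓕⁻ (corr g₄ g₃) x) * 𝓕⁻ (corr g₁ g₂) x := by
    intro x
    rw [fourierInv_corr n₄ n₃, fourierInv_corr n₁ n₂, map_mul, Complex.conj_conj]
    ring
  simp_rw [e1]
  have hi := integrable_resonant n₁ n₂ n₃ n₄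
  rw [h, Measure.volume_eq_prod, integral_prod _ hi]
  apply integral_congr_ae
  filter_upwards [hi.prod_right_ae] with a ha
  rw [Measure.volume_eq_prod, integral_prod _ ha, corr, corr, ← integral_const_mul]
  apply integral_congr_ae
  filter_upwards with y
  simp only [resonant]
  rw [integral_const_mul, mul_comm, ← integral_conj, ← integral_add_left_eq_self _ y]
  congr 1
  apply integral_congr_ae
  filter_upwards with b
  rw [map_mul, Complex.conj_conj, mul_comm, show y + b + a = y + a + b by ring]

/-! ### Quadratic phases and averaging in time -/

/-- The quadratic phase `e^{ity²}`. -/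
def chirp (t y : ℝ) : ℂ := Complex.exp ((t * y ^ 2 : ℝ) * Complex.I)

theorem norm_chirp (t y : ℝ) : ‖chirp t y‖ = 1 := Complex.norm_exp_ofReal_mul_I _

theorem continuous_chirp : Continuous (fun p : ℝ × ℝ => chirp p.1 p.2) := by
  unfold chirp; fun_prop

theorem continuous_chirp_right (t : ℝ) : Continuous (chirp t) := by
  unfold chirp; fun_prop

theorem Nice.chirp {h : ℝ → ℂ} (hh : Nice h) (t : ℝ) :
    Nice (fun y => DispersionManagement.chirp t y * h y) :=
  hh.mul (continuous_chirp_right t).measurable fun x => (norm_chirp t x).le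

/-- This is the identity `-y² + (y+a)² - (y+a+b)² + (y+b)² = -2ab`: the total phase does not depend
on `y`. -/
theorem resonant_chirp (h₁ h₂ h₃ h₄ : ℝ → ℂ) (t : ℝ) (p : ℝ × ℝ × ℝ) :
    resonant (fun y => chirp t y * h₁ y) (fun y => chirp t y * h₂ y)
      (fun y => chirp t y * h₃ y) (fun y => chirp t y * h₄ y) p =
    Complex.exp ((-2 * t * (p.1 * p.2.2) : ℝ) * Complex.I) * resonant h₁ h₂ h₃ h₄ p := by
  have hc : ∀ y, (starRingEnd ℂ) (chirp t y) = Complex.exp ((-(t * y ^ 2) : ℝ) * Complex.I) := by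
    intro y
    rw [chirp, ← Complex.exp_conj, map_mul, Complex.conj_ofReal, Complex.conj_I]
    congr 1; push_cast; ring
  simp only [resonant, map_mul, hc]
  have : Complex.exp ((-2 * t * (p.1 * p.2.2) : ℝ) * Complex.I) =
    Complex.exp ((-(t * p.2.1 ^ 2) : ℝ) * Complex.I) * chirp t (p.2.1 + p.1) *
      (Complex.exp ((-(t * (p.2.1 + p.1 + p.2.2) ^ 2) : ℝ) * Complex.I) *
        chirp t (p.2.1 + p.2.2)) := by
    simp only [chirp, ← Complex.exp_add]
    congr 1; push_cast; ring
  rw [this]; ring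

/-- Averaging in time first: the oscillatory integral becomes a kernel in `ab`. -/
theorem enorm_setIntegral_resonant_le {h₁ h₂ h₃ h₄ : ℝ → ℂ} (n₁ : Nice h₁) (n₂ : Nice h₂)
    (n₃ : Nice h₃) (n₄ : Nice h₄) {s : Set ℝ} {w : ℝ → ℂ} {t : ℝ → ℝ} (hw : IntegrableOn w s)
    (ht : Measurable t) {K : ℝ → ℝ≥0∞}
    (hK : ∀ σ : ℝ, ‖∫ r in s, w r * Complex.exp ((-2 * t r * σ : ℝ) * Complex.I)‖ₑ ≤ K σ) :
    ‖∫ r in s, w r * ∫ x, (starRingEnd ℂ) (𝓕⁻ (fun y => chirp (t r) y * h₁ y) x) *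
        𝓕⁻ (fun y => chirp (t r) y * h₂ y) x *
        (starRingEnd ℂ) (𝓕⁻ (fun y => chirp (t r) y * h₃ y) x) *
        𝓕⁻ (fun y => chirp (t r) y * h₄ y) x‖ₑ ≤
      ∫⁻ p : ℝ × ℝ × ℝ, K (p.1 * p.2.2) * ‖resonant h₁ h₂ h₃ h₄ p‖ₑ := by
  have e : ∀ r, w r * ∫ x, (starRingEnd ℂ) (𝓕⁻ (fun y => chirp (t r) y * h₁ y) x) *
        𝓕⁻ (fun y => chirp (t r) y * h₂ y) x *
        (starRingEnd ℂ) (𝓕⁻ (fun y => chirp (t r) y * h₃ y) x) *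
        𝓕⁻ (fun y => chirp (t r) y * h₄ y) x = ∫ p : ℝ × ℝ × ℝ,
      Complex.exp ((-2 * t r * (p.1 * p.2.2) : ℝ) * Complex.I) *
        (w r * resonant h₁ h₂ h₃ h₄ p) := by
    intro r
    rw [integral_fourierInv_four (n₁.chirp _) (n₂.chirp _) (n₃.chirp _) (n₄.chirp _),
      ← integral_const_mul]
    simp_rw [resonant_chirp]
    congr 1; ext p; ring
  simp_rw [e]
  have hi : Integrable (Function.uncurry fun (r : ℝ) (p : ℝ × ℝ × ℝ) =>
      Complex.exp ((-2 * t r * (p.1 * p.2.2) : ℝ) * Complex.I) *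
        (w r * resonant h₁ h₂ h₃ h₄ p)) ((volume.restrict s).prod volume) := by
    refine (Integrable.mul_prod hw (integrable_resonant n₁ n₂ n₃ n₄)).bdd_mul (c := 1)
      ?_ (Eventually.of_forall fun p => (Complex.norm_exp_ofReal_mul_I _).le)
    exact Measurable.aestronglyMeasurable (by fun_prop)
  rw [integral_integral_swap hi]
  refine (enorm_integral_le_lintegral_enorm _).trans (lintegral_mono fun p => ?_)
  have : ∫ r in s, Complex.exp ((-2 * t r * (p.1 * p.2.2) : ℝ) * Complex.I) *
        (w r * resonant h₁ h₂ h₃ h₄ p) = (∫ r in s, w r *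
        Complex.exp ((-2 * t r * (p.1 * p.2.2) : ℝ) * Complex.I)) * resonant h₁ h₂ h₃ h₄ p := by
    rw [← integral_mul_const]
    congr 1; ext r; ring
  rw [this, enorm_mul]
  gcongr
  exact hK _

/-! ### The absolute quadrilinear form and its `L²` bounds -/

/-- The `L²` size `(∫⁻ u²)^{1/2}` of a nonnegative function. -/
def size (u : ℝ → ℝ≥0∞) : ℝ≥0∞ := (∫⁻ x, u x ^ (2 : ℝ)) ^ (1 / 2 : ℝ)

/-- The kernel `min(t^{-1/4}, t^{-3/4})`. -/
def kern (t : ℝ≥0∞) : ℝ≥0∞ := min ((t ^ (1 / 4 : ℝ))⁻¹) ((t ^ (3 / 4 : ℝ))⁻¹)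

theorem kern_antitone : Antitone kern := fun s t hst => by
  unfold kern
  gcongr

theorem measurable_kern : Measurable kern := by
  unfold kern
  fun_prop

/-- The product `u₁(y) u₂(y+a) u₃(y+a+b) u₄(y+b)` at `(a, (y, b))`. -/
def resProd (u₁ u₂ u₃ u₄ : ℝ → ℝ≥0∞) (p : ℝ × ℝ × ℝ) : ℝ≥0∞ :=
  u₁ p.2.1 * u₂ (p.2.1 + p.1) * (u₃ (p.2.1 + p.1 + p.2.2) * u₄ (p.2.1 + p.2.2))

theorem enorm_resonant (h₁ h₂ h₃ h₄ : ℝ → ℂ) (p : ℝ × ℝ × ℝ) :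
    ‖resonant h₁ h₂ h₃ h₄ p‖ₑ = resProd (fun y => ‖h₁ y‖ₑ) (fun y => ‖h₂ y‖ₑ) (fun y => ‖h₃ y‖ₑ)
      (fun y => ‖h₄ y‖ₑ) p := by
  simp [resonant, resProd, enorm_mul]

theorem measurable_resProd {u₁ u₂ u₃ u₄ : ℝ → ℝ≥0∞} (m₁ : Measurable u₁) (m₂ : Measurable u₂)
    (m₃ : Measurable u₃) (m₄ : Measurable u₄) : Measurable (resProd u₁ u₂ u₃ u₄) := by
  unfold resProd
  fun_prop

theorem lintegral_mul_translate_le {u v : ℝ → ℝ≥0∞} (hu : Measurable u) (hv : Measurable v)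
    (c d : ℝ) : ∫⁻ x, u (c + x) * v (d + x) ≤ size u * size v := by
  have h := ENNReal.lintegral_mul_le_Lp_mul_Lq volume Real.HolderConjugate.two_two
    (f := fun x => u (c + x)) (g := fun x => v (d + x))
    (hu.comp (measurable_const_add c)).aemeasurable (hv.comp (measurable_const_add d)).aemeasurable
  have e1 := lintegral_add_left_eq_self (μ := volume) (fun x => u x ^ (2:ℝ)) c
  have e2 := lintegral_add_left_eq_self (μ := volume) (fun x => v x ^ (2:ℝ)) d
  rw [e1, e2] at h
  exact h

/-- With `a` frozen, Cauchy–Schwarz in `b` handles `u₃, u₄` and then Cauchy–Schwarz in `y` handles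
`u₁, u₂`; only the weight is left in `a`. -/
theorem lintegral_left_weight_le {u₁ u₂ u₃ u₄ : ℝ → ℝ≥0∞} (m₁ : Measurable u₁)
    (m₂ : Measurable u₂) (m₃ : Measurable u₃) (m₄ : Measurable u₄) {κ : ℝ → ℝ≥0∞}
    (hκ : Measurable κ) :
    ∫⁻ p : ℝ × ℝ × ℝ, κ p.1 * resProd u₁ u₂ u₃ u₄ p ≤
      (∫⁻ a, κ a) * (size u₁ * size u₂ * size u₃ * size u₄) := by
  have hm : Measurable fun p : ℝ × ℝ × ℝ => κ p.1 * resProd u₁ u₂ u₃ u₄ p :=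
    (hκ.comp measurable_fst).mul (measurable_resProd m₁ m₂ m₃ m₄)
  rw [Measure.volume_eq_prod, lintegral_prod _ hm.aemeasurable, ← lintegral_mul_const _ hκ]
  apply lintegral_mono
  intro a
  simp only
  have hra : Measurable fun q : ℝ × ℝ => resProd u₁ u₂ u₃ u₄ (a, q) :=
    (measurable_resProd m₁ m₂ m₃ m₄).comp (by fun_prop)
  rw [lintegral_const_mul _ hra]
  gcongr
  rw [Measure.volume_eq_prod, lintegral_prod _ hra.aemeasurable]
  calc ∫⁻ y, ∫⁻ b, resProd u₁ u₂ u₃ u₄ (a, y, b)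
      ≤ ∫⁻ y, u₁ (0 + y) * u₂ (a + y) * (size u₃ * size u₄) := by
        apply lintegral_mono
        intro y
        simp only [resProd]
        rw [lintegral_const_mul _ (by fun_prop), zero_add, add_comm a y]
        gcongr
        exact lintegral_mul_translate_le m₃ m₄ _ _
    _ = (∫⁻ y, u₁ (0 + y) * u₂ (a + y)) * (size u₃ * size u₄) :=
        lintegral_mul_const _ (by fun_prop)
    _ ≤ (size u₁ * size u₂) * (size u₃ * size u₄) := by
        gcongr
        exact lintegral_mul_translate_le m₁ m₂ _ _
    _ = _ := by ring

/-- With `b` frozen the pairing changes: `u₂, u₃` are integrated in `a`, then `u₁, u₄` in `y`. -/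
theorem lintegral_right_weight_le {u₁ u₂ u₃ u₄ : ℝ → ℝ≥0∞} (m₁ : Measurable u₁)
    (m₂ : Measurable u₂) (m₃ : Measurable u₃) (m₄ : Measurable u₄) {κ : ℝ → ℝ≥0∞}
    (hκ : Measurable κ) :
    ∫⁻ p : ℝ × ℝ × ℝ, κ p.2.2 * resProd u₁ u₂ u₃ u₄ p ≤
      (∫⁻ a, κ a) * (size u₁ * size u₂ * size u₃ * size u₄) := by
  have hr := measurable_resProd m₁ m₂ m₃ m₄
  have hm : Measurable fun p : ℝ × ℝ × ℝ => κ p.2.2 * resProd u₁ u₂ u₃ u₄ p :=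
    (hκ.comp (by fun_prop)).mul hr
  have hm2 : Measurable fun q : ℝ × ℝ => ∫⁻ a, κ q.2 * resProd u₁ u₂ u₃ u₄ (a, q) :=
    hm.lintegral_prod_left'
  rw [Measure.volume_eq_prod, lintegral_prod_symm' _ hm, Measure.volume_eq_prod,
    lintegral_prod_symm' _ hm2, ← lintegral_mul_const _ hκ]
  apply lintegral_mono
  intro b
  simp only
  calc ∫⁻ y, ∫⁻ a, κ b * resProd u₁ u₂ u₃ u₄ (a, y, b)
      ≤ ∫⁻ y, κ b * (size u₂ * size u₃) * (u₁ (0 + y) * u₄ (b + y)) := by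
        apply lintegral_mono
        intro y
        simp only [resProd]
        have e : ∀ a, κ b * (u₁ y * u₂ (y + a) * (u₃ (y + a + b) * u₄ (y + b))) =
            (κ b * u₁ y * u₄ (y + b)) * (u₂ (y + a) * u₃ ((y + b) + a)) := by
          intro a
          rw [show y + a + b = y + b + a by ring]; ring
        simp_rw [e]
        rw [lintegral_const_mul _ (by fun_prop), zero_add, add_comm b y]
        calc _ ≤ κ b * u₁ y * u₄ (y + b) * (size u₂ * size u₃) := by
              gcongr
              exact lintegral_mul_translate_le m₂ m₃ _ _
          _ = _ := by ring
    _ = κ b * (size u₂ * size u₃) * ∫⁻ y, (u₁ (0 + y) * u₄ (b + y)) :=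
        lintegral_const_mul _ (by fun_prop)
    _ ≤ κ b * (size u₂ * size u₃) * (size u₁ * size u₄) := by
        gcongr
        exact lintegral_mul_translate_le m₁ m₄ _ _
    _ = _ := by ring

/-- The weight `(|x| max(|x|, s))^{-3/4}`. -/
def weight (s : ℝ≥0∞) (x : ℝ) : ℝ≥0∞ := ((‖x‖ₑ * max ‖x‖ₑ s) ^ (3 / 4 : ℝ))⁻¹

theorem measurable_weight (s : ℝ≥0∞) : Measurable (weight s) := by
  unfold weight
  fun_prop

/-- The exponent `3/4` serves both ends: `|x|^{-3/4}` is integrable at zero and `|x|^{-3/2}` at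
infinity. -/
theorem lintegral_weight_one_lt_top : ∫⁻ x, weight 1 x < ⊤ := by
  have hneg : ∀ x, weight 1 (-x) = weight 1 x := by intro x; simp [weight]
  have hsplit : ∫⁻ x, weight 1 x = (∫⁻ x in Set.Ioi 0, weight 1 x) + ∫⁻ x in Set.Ioi 0, weight 1 x := by
    have h := lintegral_add_compl (μ := volume) (weight 1) (measurableSet_Ioi (a := (0:ℝ)))
    have h2 : ∫⁻ x in (Set.Ioi (0:ℝ))ᶜ, weight 1 x = ∫⁻ x in Set.Ioi (0:ℝ), weight 1 x := by
      rw [Set.compl_Ioi, setLIntegral_congr Iio_ae_eq_Iic.symm,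
        ← lintegral_indicator measurableSet_Iio, ← lintegral_indicator measurableSet_Ioi,
        ← lintegral_neg_eq_self]
      congr 1; ext x
      simp only [Set.indicator, Set.mem_Iio, Set.mem_Ioi, Left.neg_neg_iff, hneg]
    rw [← h, h2]
  have hle1 : ∫⁻ x in Set.Ioc (0:ℝ) 1, weight 1 x < ⊤ := by
    have := (intervalIntegral.intervalIntegrable_rpow' (r := -(3/4)) (by norm_num)
      (a := 0) (b := 1))
    rw [intervalIntegrable_iff_integrableOn_Ioc_of_le zero_le_one] at this
    refine lt_of_eq_of_lt (setLIntegral_congr_fun measurableSet_Ioc ?_) this.2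
    intro x hx
    simp only [weight]
    have h1 : ‖x‖ₑ ≤ 1 := by
      rw [enorm_eq_ofReal hx.1.le]; simpa using hx.2
    rw [max_eq_right h1, mul_one, Real.enorm_eq_ofReal hx.1.le,
      Real.enorm_eq_ofReal (Real.rpow_nonneg hx.1.le _), ENNReal.ofReal_rpow_of_pos hx.1,
      ← ENNReal.ofReal_inv_of_pos (Real.rpow_pos_of_pos hx.1 _), Real.rpow_neg hx.1.le]
  have hle2 : ∫⁻ x in Set.Ioi (1:ℝ), weight 1 x < ⊤ := by
    have := integrableOn_Ioi_rpow_of_lt (a := -(3/2)) (by norm_num) (zero_lt_one)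
    refine lt_of_eq_of_lt (setLIntegral_congr_fun measurableSet_Ioi ?_) this.2
    intro x hx
    have hx0 : (0:ℝ) < x := zero_lt_one.trans hx
    simp only [weight]
    have h1 : 1 ≤ ‖x‖ₑ := by
      rw [enorm_eq_ofReal hx0.le]; simpa using hx.le
    rw [max_eq_left h1, Real.enorm_eq_ofReal hx0.le,
      Real.enorm_eq_ofReal (Real.rpow_nonneg hx0.le _), ← ENNReal.ofReal_mul hx0.le,
      ENNReal.ofReal_rpow_of_pos (by positivity),
      ← ENNReal.ofReal_inv_of_pos (by positivity), Real.rpow_neg hx0.le]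
    congr 2
    rw [← sq, ← Real.rpow_natCast, ← Real.rpow_mul hx0.le]
    norm_num
  have : ∫⁻ x in Set.Ioi (0:ℝ), weight 1 x < ⊤ := by
    rw [← Set.Ioc_union_Ioi_eq_Ioi zero_le_one]
    exact (lintegral_union_le _ _ _).trans_lt (ENNReal.add_lt_top.2 ⟨hle1, hle2⟩)
  rw [hsplit]
  exact ENNReal.add_lt_top.2 ⟨this, this⟩

/-- Scaling: `x ↦ s x` contributes the Jacobian `s`, and the weight is homogeneous of degree `-3/2`
in `(x, s)`. This is the source of the gain `s^{-1/2}`. -/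
theorem lintegral_weight_eq {s : ℝ} (hs : 0 < s) :
    ∫⁻ x, weight (ENNReal.ofReal s) x =
      (ENNReal.ofReal s ^ (1 / 2 : ℝ))⁻¹ * ∫⁻ x, weight 1 x := by
  set S := ENNReal.ofReal s with hS
  have hS0 : S ≠ 0 := by simpa [hS] using hs
  have hSt : S ≠ ⊤ := ENNReal.ofReal_ne_top
  conv_lhs => rw [← Real.smul_map_volume_mul_left hs.ne']
  rw [lintegral_smul_measure, lintegral_map (measurable_weight _) (measurable_const_mul s),
    abs_of_pos hs]
  have e : ∀ x, weight S (s * x) = (S ^ (3 / 2 : ℝ))⁻¹ * weight 1 x := by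
    intro x
    have e1 : ‖s * x‖ₑ = S * ‖x‖ₑ := by rw [enorm_mul, Real.enorm_eq_ofReal hs.le]
    have e2 : max (S * ‖x‖ₑ) S = S * max ‖x‖ₑ 1 := by
      rw [mul_max, mul_one]
    have e3 : S * ‖x‖ₑ * (S * max ‖x‖ₑ 1) = S ^ (2 : ℝ) * (‖x‖ₑ * max ‖x‖ₑ 1) := by
      rw [show (2:ℝ) = ((2:ℕ):ℝ) by norm_num, ENNReal.rpow_natCast]; ring
    rw [weight, e1, e2, e3, ENNReal.mul_rpow_of_nonneg _ _ (by norm_num), ← ENNReal.rpow_mul,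
      ENNReal.mul_inv, weight]
    · norm_num
    · left; simp [hS0, hSt]
    · left; simp [hS0, hSt]
  simp_rw [e]
  rw [lintegral_const_mul _ (measurable_weight 1), smul_eq_mul, ← mul_assoc, ← hS]
  congr 1
  rw [← ENNReal.rpow_neg, ← ENNReal.rpow_neg]
  nth_rewrite 1 [← ENNReal.rpow_one S]
  rw [← ENNReal.rpow_add _ _ hS0 hSt]
  norm_num

/-- The larger of `|a|, |b|` dominates both the smaller one and `s`, so the kernel is bounded by the
weight at the smaller variable. This trades a kernel in the product `ab` for integrable weights in
one variable. -/
theorem kern_le_weight (s : ℝ≥0∞) {a b : ℝ} (hs : s ≤ max ‖a‖ₑ ‖b‖ₑ) :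
    kern ‖a * b‖ₑ ≤ weight s a + weight s b := by
  rw [enorm_mul]
  rcases le_total ‖a‖ₑ ‖b‖ₑ with h | h
  · refine le_trans ?_ (self_le_add_right _ _)
    refine (min_le_right _ _).trans ?_
    rw [max_eq_right h] at hs
    unfold weight
    gcongr
    exact max_le h hs
  · refine le_trans ?_ (self_le_add_left _ _)
    refine (min_le_right _ _).trans ?_
    rw [max_eq_left h] at hs
    rw [mul_comm]
    unfold weight
    gcongr
    exact max_le h hs

theorem kern_mul_self_le_weight (t : ℝ≥0∞) : kern (t * t) ≤ ((t * max t 1) ^ (3 / 4 : ℝ))⁻¹ := by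
  rcases le_total t 1 with h | h
  · rw [max_eq_right h, mul_one]
    refine (min_le_left _ _).trans ?_
    rw [ENNReal.mul_rpow_of_nonneg _ _ (by norm_num), ← ENNReal.rpow_add_of_nonneg _ _ (by norm_num)
      (by norm_num)]
    rw [ENNReal.inv_le_inv]
    exact ENNReal.rpow_le_rpow_of_exponent_ge h (by norm_num)
  · rw [max_eq_left h]
    exact min_le_right _ _

/-- Here no separation is assumed. The kernel decreases, so `|ab|` may be replaced by the square of
the smaller modulus; for small values the exponent `1/4` of `kern` gives `t^{-1/2} ≤ t^{-3/4}`. -/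
theorem kern_le_weight_one (a b : ℝ) : kern ‖a * b‖ₑ ≤ weight 1 a + weight 1 b := by
  rw [enorm_mul]
  rcases le_total ‖a‖ₑ ‖b‖ₑ with h | h
  · refine le_trans ?_ (self_le_add_right _ _)
    exact (kern_antitone (by gcongr)).trans (kern_mul_self_le_weight _)
  · refine le_trans ?_ (self_le_add_left _ _)
    exact (kern_antitone (by gcongr)).trans (kern_mul_self_le_weight _)

theorem lintegral_resProd_le_of_le {u₁ u₂ u₃ u₄ : ℝ → ℝ≥0∞} (m₁ : Measurable u₁)
    (m₂ : Measurable u₂) (m₃ : Measurable u₃) (m₄ : Measurable u₄) {κ : ℝ → ℝ≥0∞}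
    (hκ : Measurable κ) {F : ℝ × ℝ × ℝ → ℝ≥0∞}
    (hF : ∀ p, F p ≤ (κ p.1 + κ p.2.2) * resProd u₁ u₂ u₃ u₄ p) :
    ∫⁻ p, F p ≤ 2 * (∫⁻ a, κ a) * (size u₁ * size u₂ * size u₃ * size u₄) := by
  have hr := measurable_resProd m₁ m₂ m₃ m₄
  calc ∫⁻ p, F p ≤ ∫⁻ p : ℝ × ℝ × ℝ, (κ p.1 * resProd u₁ u₂ u₃ u₄ p +
        κ p.2.2 * resProd u₁ u₂ u₃ u₄ p) := by
        apply lintegral_mono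
        intro p
        simpa only [← add_mul] using hF p
    _ ≤ _ := by
        have hk : Measurable fun p : ℝ × ℝ × ℝ => κ p.1 * resProd u₁ u₂ u₃ u₄ p :=
          (hκ.comp measurable_fst).mul hr
        rw [lintegral_add_left hk, two_mul, add_mul]
        gcongr
        · exact lintegral_left_weight_le m₁ m₂ m₃ m₄ hκ
        · exact lintegral_right_weight_le m₁ m₂ m₃ m₄ hκ

/-- The absolute quadrilinear form with kernel `kern |ab|`. -/
def absForm (u₁ u₂ u₃ u₄ : ℝ → ℝ≥0∞) : ℝ≥0∞ :=
  ∫⁻ p : ℝ × ℝ × ℝ, kern ‖p.1 * p.2.2‖ₑ * resProd u₁ u₂ u₃ u₄ p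

/-- The constant of the quadrilinear estimates. -/
def formConst : ℝ≥0∞ := 2 * ∫⁻ x, weight 1 x

theorem formConst_lt_top : formConst < ⊤ :=
  ENNReal.mul_lt_top (by norm_num) lintegral_weight_one_lt_top

theorem absForm_le {u₁ u₂ u₃ u₄ : ℝ → ℝ≥0∞} (m₁ : Measurable u₁)
    (m₂ : Measurable u₂) (m₃ : Measurable u₃) (m₄ : Measurable u₄) :
    absForm u₁ u₂ u₃ u₄ ≤ formConst * (size u₁ * size u₂ * size u₃ * size u₄) :=
  lintegral_resProd_le_of_le m₁ m₂ m₃ m₄ (measurable_weight 1) fun p => by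
    gcongr
    exact kern_le_weight_one _ _

/-- The part of the quadrilinear form where some separation is at least `s`. -/
theorem lintegral_separated_le {u₁ u₂ u₃ u₄ : ℝ → ℝ≥0∞} (m₁ : Measurable u₁)
    (m₂ : Measurable u₂) (m₃ : Measurable u₃) (m₄ : Measurable u₄) {s : ℝ} (hs : 0 < s) :
    ∫⁻ p, {p : ℝ × ℝ × ℝ | s ≤ max |p.1| |p.2.2|}.indicator
      (fun p => kern ‖p.1 * p.2.2‖ₑ * resProd u₁ u₂ u₃ u₄ p) p ≤
      (ENNReal.ofReal s ^ (1 / 2 : ℝ))⁻¹ * formConst * (size u₁ * size u₂ * size u₃ * size u₄) := by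
  refine (lintegral_resProd_le_of_le m₁ m₂ m₃ m₄ (measurable_weight (ENNReal.ofReal s))
    fun p => ?_).trans_eq ?_
  · rw [Set.indicator_apply]
    split_ifs with hp
    swap
    · exact zero_le
    gcongr
    apply kern_le_weight
    rw [← ofReal_norm, ← ofReal_norm, ← ENNReal.ofReal_max]
    exact ENNReal.ofReal_le_ofReal hp
  · rw [lintegral_weight_eq hs, formConst]
    ring

theorem size_enorm (h : ℝ → ℂ) : size (fun x => ‖h x‖ₑ) = eLpNorm h 2 volume := by
  rw [eLpNorm_eq_lintegral_rpow_enorm_toReal (by norm_num) (by norm_num), size]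
  simp

/-- At `σ = 0` the kernel is `⊤`, so the power bounds are only needed away from zero. -/
theorem enorm_le_kern {z : ℂ} {C σ : ℝ} (hC : 0 < C)
    (h : σ ≠ 0 → ‖z‖ ≤ C * |σ| ^ (-(1 / 4) : ℝ) ∧ ‖z‖ ≤ C * |σ| ^ (-(3 / 4) : ℝ)) :
    ‖z‖ₑ ≤ ENNReal.ofReal C * kern ‖σ‖ₑ := by
  rcases eq_or_ne σ 0 with h0 | h0
  · have : ENNReal.ofReal C ≠ 0 := by simpa using hC
    simp [h0, kern, ENNReal.mul_top this]
  · obtain ⟨h1, h2⟩ := h h0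
    have hp : 0 < |σ| := abs_pos.2 h0
    have e : ∀ q : ℝ, (‖σ‖ₑ ^ q)⁻¹ = ENNReal.ofReal (|σ| ^ (-q)) := by
      intro q
      rw [← ofReal_norm, Real.norm_eq_abs, ENNReal.ofReal_rpow_of_pos hp,
        ← ENNReal.ofReal_inv_of_pos (by positivity), Real.rpow_neg hp.le]
    rw [kern, e, e, mul_min, ← ENNReal.ofReal_mul hC.le, ← ENNReal.ofReal_mul hC.le, ← ofReal_norm]
    exact le_min (ENNReal.ofReal_le_ofReal h1) (ENNReal.ofReal_le_ofReal h2)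

/-! ### The free evolution of nice Fourier data and its `L⁴` bound -/

theorem schrodingerSymbol_eq_chirp (r ξ : ℝ) :
    schrodingerSymbol r ξ = chirp (-(4 * π ^ 2 * r)) ξ := by
  rw [schrodingerSymbol, chirp]
  congr 1; push_cast; ring

theorem coeFn_fourier_T (r : ℝ) (f : L2) :
    ((𝓕 (T r f) : L2) : ℝ → ℂ) =ᵐ[volume] fun ξ => schrodingerSymbol r ξ * (𝓕 f : L2) ξ := by
  have : (𝓕 (T r f) : L2) = (memLp_schrodingerSymbol_mul r (𝓕 f)).toLp
    (fun ξ => schrodingerSymbol r ξ * (𝓕 f : L2) ξ) := by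
    rw [T]; exact FourierTransform.fourier_fourierInv_eq _
  rw [this]
  exact MemLp.coeFn_toLp _

theorem fourier_injective : Function.Injective (fun f : L2 => (𝓕 f : L2)) :=
  (Lp.fourierTransformₗᵢ ℝ ℂ).injective

theorem fourier_sub_L2 (f g : L2) : (𝓕 (f - g) : L2) = 𝓕 f - 𝓕 g :=
  (Lp.fourierTransformₗᵢ ℝ ℂ).map_sub f g

theorem T_sub (r : ℝ) (f g : L2) : T r (f - g) = T r f - T r g := by
  apply fourier_injective
  simp only
  rw [fourier_sub_L2]
  apply Lp.ext
  filter_upwards [coeFn_fourier_T r (f - g), coeFn_fourier_T r f, coeFn_fourier_T r g,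
    Lp.coeFn_sub (𝓕 (T r f) : L2) (𝓕 (T r g)), Lp.coeFn_sub (𝓕 f : L2) (𝓕 g)] with x h1 h2 h3 h4 h5
  rw [h1, h4, Pi.sub_apply, h2, h3, fourier_sub_L2, h5, Pi.sub_apply, mul_sub]

theorem norm_T (r : ℝ) (f : L2) : ‖T r f‖ = ‖f‖ := by
  rw [← Lp.norm_fourier_eq (T r f), ← Lp.norm_fourier_eq f]
  apply le_antisymm
  · apply Lp.norm_le_norm_of_ae_le
    filter_upwards [coeFn_fourier_T r f] with x hx
    rw [hx, norm_mul, norm_schrodingerSymbol, one_mul]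
  · apply Lp.norm_le_norm_of_ae_le
    filter_upwards [coeFn_fourier_T r f] with x hx
    rw [hx, norm_mul, norm_schrodingerSymbol, one_mul]

/-- The evolution at time `r` with nice Fourier data `h`, as an integral. -/
def evo (h : ℝ → ℂ) (r x : ℝ) : ℂ := 𝓕⁻ (fun ξ => chirp (-(4 * π ^ 2 * r)) ξ * h ξ) x

theorem T_ae_eq_evo {h : ℝ → ℂ} (hh : Nice h) (r : ℝ) :
    (T r (𝓕⁻ (hh.memLp.toLp h) : L2) : ℝ → ℂ) =ᵐ[volume] evo h r := by
  have e : T r (𝓕⁻ (hh.memLp.toLp h) : L2) = 𝓕⁻ ((hh.chirp (-(4 * π ^ 2 * r))).memLp.toLp _ : L2) := by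
    rw [T]
    congr 1
    apply MemLp.toLp_congr
    rw [FourierTransform.fourier_fourierInv_eq]
    filter_upwards [hh.memLp.coeFn_toLp] with x hx
    rw [hx, schrodingerSymbol_eq_chirp]
  rw [e]
  exact fourierInv_toLp_ae_eq (hh.chirp _).integrable _

theorem measurable_evo {h : ℝ → ℂ} (hh : Nice h) : Measurable fun p : ℝ × ℝ => evo h p.1 p.2 := by
  simp_rw [evo, fourierInv_real_eq]
  have hm : Measurable fun q : (ℝ × ℝ) × ℝ => Complex.exp (2 * π * q.1.2 * q.2 * Complex.I) *
      (chirp (-(4 * π ^ 2 * q.1.1)) q.2 * h q.2) := by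
    have h1 : Measurable fun q : (ℝ × ℝ) × ℝ => chirp (-(4 * π ^ 2 * q.1.1)) q.2 :=
      (continuous_chirp.comp (f := fun q : (ℝ × ℝ) × ℝ => (-(4 * π ^ 2 * q.1.1), q.2))
        (by fun_prop)).measurable
    have h2 := hh.measurable
    fun_prop
  exact (hm.stronglyMeasurable.integral_prod_right' (ν := volume)).measurable

theorem evo_sub {h g : ℝ → ℂ} (hh : Nice h) (hg : Nice g) (r x : ℝ) :
    evo (fun y => h y - g y) r x = evo h r x - evo g r x := by
  have hi : ∀ {u : ℝ → ℂ}, Nice u → Integrable fun y : ℝ => Complex.exp (2 * π * x * y * Complex.I) * u y := by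
    intro u hu
    refine hu.integrable.bdd_mul (c := 1) (by fun_prop) (Eventually.of_forall fun y => ?_)
    rw [show (2 * π * x * y * Complex.I : ℂ) = ((2 * π * x * y : ℝ) : ℂ) * Complex.I by
      push_cast; ring, Complex.norm_exp_ofReal_mul_I]
  simp only [evo, fourierInv_real_eq, mul_sub]
  exact integral_sub (hi (hh.chirp _)) (hi (hg.chirp _))

theorem norm_fourierInv_le (h : ℝ → ℂ) (x : ℝ) : ‖𝓕⁻ h x‖ ≤ ∫ y, ‖h y‖ := by
  rw [fourierInv_real_eq]
  refine (norm_integral_le_integral_norm _).trans_eq ?_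
  congr 1; ext y
  rw [norm_mul, show (2 * π * x * y * Complex.I : ℂ) = ((2 * π * x * y : ℝ) : ℂ) * Complex.I by
      push_cast; ring, Complex.norm_exp_ofReal_mul_I, one_mul]

/-- The transform is bounded because `h` is in `L¹`, and is in `L²` by Plancherel. Hence it is in
`L⁴`, so the Bochner integral on the right is the true one. -/
theorem lintegral_fourierInv_pow_four {h : ℝ → ℂ} (hh : Nice h) :
    ∫⁻ x, ‖𝓕⁻ h x‖ₑ ^ (4 : ℝ) = ‖∫ x, (starRingEnd ℂ) (𝓕⁻ h x) * 𝓕⁻ h x *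
      (starRingEnd ℂ) (𝓕⁻ h x) * 𝓕⁻ h x‖ₑ := by
  have hF : MemLp (𝓕⁻ h) 2 volume :=
    (memLp_congr_ae (fourierInv_toLp_ae_eq hh.integrable hh.memLp)).1 (Lp.memLp _)
  have hsq : Integrable (fun x => ‖𝓕⁻ h x‖ ^ 2) := hF.integrable_norm_pow (by norm_num)
  have h4 : Integrable (fun x => ‖𝓕⁻ h x‖ ^ 4) := by
    have : ∀ x, ‖𝓕⁻ h x‖ ^ 4 = ‖𝓕⁻ h x‖ ^ 2 * ‖𝓕⁻ h x‖ ^ 2 := fun x => by ring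
    simp_rw [this]
    refine hsq.bdd_mul (c := (∫ y, ‖h y‖) ^ 2) hsq.aestronglyMeasurable (Eventually.of_forall fun x => ?_)
    rw [Real.norm_of_nonneg (by positivity)]
    gcongr
    exact norm_fourierInv_le h x
  have e : ∀ x, (starRingEnd ℂ) (𝓕⁻ h x) * 𝓕⁻ h x * (starRingEnd ℂ) (𝓕⁻ h x) * 𝓕⁻ h x =
      ((‖𝓕⁻ h x‖ ^ 4 : ℝ) : ℂ) := by
    intro x
    rw [mul_assoc, ← Complex.normSq_eq_conj_mul_self, Complex.normSq_eq_norm_sq]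
    push_cast; ring
  simp_rw [e]
  rw [integral_complex_ofReal, ← ofReal_norm, Complex.norm_real,
    Real.norm_of_nonneg (by positivity), ofReal_integral_eq_lintegral_ofReal h4
      (Eventually.of_forall fun x => by positivity)]
  congr 1; ext x
  rw [ENNReal.ofReal_pow (norm_nonneg _), ofReal_norm, ← ENNReal.rpow_natCast]
  norm_num

/-- The integral is at most `1` trivially and at most `2/(8π²|σ|)` by explicit integration; `min(1,
1/|σ|)` lies below the kernel. -/
theorem enorm_integral_time_le (σ : ℝ) :
    ‖∫ r in Set.Ioc (0:ℝ) 1, (1 : ℂ) *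
      Complex.exp ((-2 * (-(4 * π ^ 2 * r)) * σ : ℝ) * Complex.I)‖ₑ ≤ kern ‖σ‖ₑ := by
  have h1 : ‖∫ r in Set.Ioc (0:ℝ) 1, (1 : ℂ) *
      Complex.exp ((-2 * (-(4 * π ^ 2 * r)) * σ : ℝ) * Complex.I)‖ ≤ 1 := by
    refine (norm_setIntegral_le_of_norm_le_const (C := 1) (by simp) fun r _ => ?_).trans (by simp)
    rw [one_mul, Complex.norm_exp_ofReal_mul_I]
  have key := enorm_le_kern (z := ∫ r in Set.Ioc (0:ℝ) 1, (1 : ℂ) *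
      Complex.exp ((-2 * (-(4 * π ^ 2 * r)) * σ : ℝ) * Complex.I)) (C := 1) (σ := σ) one_pos ?_
  · simpa using key
  intro h0
  have hp : 0 < |σ| := abs_pos.2 h0
  have h2 : ‖∫ r in Set.Ioc (0:ℝ) 1, (1 : ℂ) *
      Complex.exp ((-2 * (-(4 * π ^ 2 * r)) * σ : ℝ) * Complex.I)‖ ≤ |σ|⁻¹ := by
    have hc : (8 * π ^ 2 * σ * Complex.I : ℂ) ≠ 0 := by
      simp [h0, Real.pi_ne_zero]
    have e : ∀ r : ℝ, (1 : ℂ) * Complex.exp ((-2 * (-(4 * π ^ 2 * r)) * σ : ℝ) * Complex.I) =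
        Complex.exp ((8 * π ^ 2 * σ * Complex.I : ℂ) * r) := by
      intro r; rw [one_mul]; congr 1; push_cast; ring
    simp_rw [e]
    rw [← intervalIntegral.integral_of_le zero_le_one, integral_exp_mul_complex hc, norm_div]
    have hn : ‖(8 * π ^ 2 * σ * Complex.I : ℂ)‖ = 8 * π ^ 2 * |σ| := by
      simp [abs_of_pos Real.pi_pos]
    have hnum : ‖Complex.exp (8 * π ^ 2 * σ * Complex.I * (1:ℝ)) -
        Complex.exp (8 * π ^ 2 * σ * Complex.I * (0:ℝ))‖ ≤ 2 := by
      refine (norm_sub_le _ _).trans ?_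
      rw [show (8 * π ^ 2 * σ * Complex.I * (1:ℝ) : ℂ) = ((8 * π ^ 2 * σ : ℝ) : ℂ) * Complex.I by
        push_cast; ring, Complex.norm_exp_ofReal_mul_I]
      norm_num
    rw [hn, div_le_iff₀ (by positivity)]
    refine hnum.trans ?_
    have : |σ|⁻¹ * (8 * π ^ 2 * |σ|) = 8 * π ^ 2 := by field_simp
    rw [this]
    nlinarith [Real.pi_gt_three]
  rcases le_total |σ| 1 with h | h
  · constructor
    · exact h1.trans (by rw [one_mul]; exact Real.one_le_rpow_of_pos_of_le_one_of_nonpos hp h (by norm_num))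
    · exact h1.trans (by rw [one_mul]; exact Real.one_le_rpow_of_pos_of_le_one_of_nonpos hp h (by norm_num))
  · rw [← Real.rpow_neg_one] at h2
    constructor
    · exact h2.trans (by rw [one_mul]; exact Real.rpow_le_rpow_of_exponent_le h (by norm_num))
    · exact h2.trans (by rw [one_mul]; exact Real.rpow_le_rpow_of_exponent_le h (by norm_num))

/-- The space-time measure on `(0, 1] × ℝ`. -/
def spaceTime : Measure (ℝ × ℝ) := (volume.restrict (Set.Ioc (0:ℝ) 1)).prod volume

theorem enorm_integral_evo_four_le {h₁ h₂ h₃ h₄ : ℝ → ℂ} (n₁ : Nice h₁) (n₂ : Nice h₂)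
    (n₃ : Nice h₃) (n₄ : Nice h₄) :
    ‖∫ r in Set.Ioc (0:ℝ) 1, ∫ x, (starRingEnd ℂ) (evo h₁ r x) * evo h₂ r x *
      (starRingEnd ℂ) (evo h₃ r x) * evo h₄ r x‖ₑ ≤
      absForm (fun x => ‖h₁ x‖ₑ) (fun x => ‖h₂ x‖ₑ) (fun x => ‖h₃ x‖ₑ) (fun x => ‖h₄ x‖ₑ) := by
  have := enorm_setIntegral_resonant_le n₁ n₂ n₃ n₄ (s := Set.Ioc 0 1) (w := fun _ => 1)
    (t := fun r => -(4 * π ^ 2 * r)) (K := fun σ => kern ‖σ‖ₑ) (by simp) (by fun_prop)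
    enorm_integral_time_le
  simp only [one_mul, enorm_resonant] at this
  exact this

/-- A Strichartz-type estimate: with four equal entries the quadrilinear form is the space-time
integral of the fourth power of the modulus. -/
theorem lintegral_evo_pow_four_le {h : ℝ → ℂ} (hh : Nice h) :
    ∫⁻ p, ‖evo h p.1 p.2‖ₑ ^ (4 : ℝ) ∂spaceTime ≤
      formConst * eLpNorm h 2 volume ^ (4 : ℝ) := by
  have hm := measurable_evo hh
  have hm4 : Measurable fun p : ℝ × ℝ => ‖evo h p.1 p.2‖ₑ ^ (4 : ℝ) := hm.enorm.pow_const _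
  have hslice : ∀ r, ∫⁻ x, ‖evo h r x‖ₑ ^ (4 : ℝ) = ‖∫ x, (starRingEnd ℂ) (evo h r x) * evo h r x *
      (starRingEnd ℂ) (evo h r x) * evo h r x‖ₑ := fun r => lintegral_fourierInv_pow_four (hh.chirp _)
  have hbound : ∀ r, ∫⁻ x, ‖evo h r x‖ₑ ^ (4 : ℝ) ≤ ∫⁻ p, ‖resonant h h h h p‖ₑ := by
    intro r
    rw [hslice]
    simp only [evo]
    rw [integral_fourierInv_four (hh.chirp _) (hh.chirp _) (hh.chirp _) (hh.chirp _)]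
    refine (enorm_integral_le_lintegral_enorm _).trans_eq ?_
    congr 1; ext p
    rw [resonant_chirp, enorm_mul, ← ofReal_norm, Complex.norm_exp_ofReal_mul_I]
    simp
  -- A crude finiteness bound comes first, since a Bochner integral of a non-integrable function
  -- would be `0` and carry no information.
  have hfin : ∫⁻ p, ‖evo h p.1 p.2‖ₑ ^ (4 : ℝ) ∂spaceTime < ⊤ := by
    rw [spaceTime, lintegral_prod _ hm4.aemeasurable]
    calc _ ≤ ∫⁻ r in Set.Ioc (0:ℝ) 1, ∫⁻ p, ‖resonant h h h h p‖ₑ := lintegral_mono fun r => hbound r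
      _ < ⊤ := by
        rw [setLIntegral_const]
        exact ENNReal.mul_lt_top (integrable_resonant hh hh hh hh).2 (by simp)
  have e : ∀ r x, (starRingEnd ℂ) (evo h r x) * evo h r x * (starRingEnd ℂ) (evo h r x) * evo h r x =
      ((‖evo h r x‖ ^ 4 : ℝ) : ℂ) := by
    intro r x
    rw [mul_assoc, ← Complex.normSq_eq_conj_mul_self, Complex.normSq_eq_norm_sq]
    push_cast; ring
  have epow : ∀ p : ℝ × ℝ, ‖evo h p.1 p.2‖ₑ ^ (4 : ℝ) = ENNReal.ofReal (‖evo h p.1 p.2‖ ^ 4) := by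
    intro p
    rw [ENNReal.ofReal_pow (norm_nonneg _), ofReal_norm, ← ENNReal.rpow_natCast]
    norm_num
  have hi : Integrable (fun p : ℝ × ℝ => ‖evo h p.1 p.2‖ ^ 4) spaceTime := by
    refine ⟨(hm.norm.pow_const 4).aestronglyMeasurable, ?_⟩
    rw [hasFiniteIntegral_iff_ofReal (Eventually.of_forall fun p => by positivity)]
    simpa only [epow] using hfin
  have hform := enorm_integral_evo_four_le hh hh hh hh
  calc ∫⁻ p, ‖evo h p.1 p.2‖ₑ ^ (4 : ℝ) ∂spaceTime
      = ENNReal.ofReal (∫ p, ‖evo h p.1 p.2‖ ^ 4 ∂spaceTime) := by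
        rw [ofReal_integral_eq_lintegral_ofReal hi (Eventually.of_forall fun p => by positivity)]
        simp_rw [epow]
    _ = ‖∫ r in Set.Ioc (0:ℝ) 1, ∫ x, (starRingEnd ℂ) (evo h r x) * evo h r x *
      (starRingEnd ℂ) (evo h r x) * evo h r x‖ₑ := by
        simp_rw [e, integral_complex_ofReal]
        rw [spaceTime, integral_prod _ hi, ← ofReal_norm, Complex.norm_real, Real.norm_of_nonneg]
        exact integral_nonneg fun r => integral_nonneg fun x => by positivity
    _ ≤ _ := hform
    _ ≤ _ := absForm_le hh.measurable.enorm hh.measurable.enorm hh.measurable.enorm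
        hh.measurable.enorm
    _ = _ := by
        rw [size_enorm, show (4:ℝ) = ((4:ℕ):ℝ) by norm_num, ENNReal.rpow_natCast]
        ring

theorem memLp_evo {h : ℝ → ℂ} (hh : Nice h) :
    MemLp (fun p : ℝ × ℝ => evo h p.1 p.2) 4 spaceTime := by
  refine ⟨(measurable_evo hh).aestronglyMeasurable, ?_⟩
  rw [eLpNorm_lt_top_iff_lintegral_rpow_enorm_lt_top (by norm_num) (by norm_num)]
  refine lt_of_le_of_lt ?_ (ENNReal.mul_lt_top formConst_lt_top
    (ENNReal.rpow_lt_top_of_nonneg (by norm_num : (0:ℝ) ≤ 4) hh.memLp.eLpNorm_ne_top))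
  simpa using lintegral_evo_pow_four_le hh

theorem eLpNorm_evo_le {h : ℝ → ℂ} (hh : Nice h) :
    eLpNorm (fun p : ℝ × ℝ => evo h p.1 p.2) 4 spaceTime ≤
      formConst ^ (1 / 4 : ℝ) * eLpNorm h 2 volume := by
  rw [eLpNorm_eq_lintegral_rpow_enorm_toReal (by norm_num) (by norm_num)]
  have := ENNReal.rpow_le_rpow (lintegral_evo_pow_four_le hh) (by norm_num : (0:ℝ) ≤ 1 / 4)
  rw [ENNReal.mul_rpow_of_nonneg _ _ (by norm_num), ← ENNReal.rpow_mul] at this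
  norm_num at this ⊢
  exact this

/-! ### The space-time lift and continuity of `Q4` -/

/-- Truncation in size and position. -/
def trunc (n : ℕ) (h : ℝ → ℂ) : ℝ → ℂ := {x | ‖h x‖ ≤ n ∧ |x| ≤ n}.indicator h

theorem enorm_trunc_le (n : ℕ) (h : ℝ → ℂ) (x : ℝ) : ‖trunc n h x‖ₑ ≤ ‖h x‖ₑ :=
  enorm_indicator_le_enorm_self _ _

theorem nice_trunc (n : ℕ) {h : ℝ → ℂ} (hh : Measurable h) : Nice (trunc n h) := by
  have hb : ∀ x, ‖trunc n h x‖ ≤ n := by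
    intro x
    rw [trunc, Set.indicator_apply]
    split_ifs with hx
    · exact hx.1
    · simp
  have hm : Measurable (trunc n h) := by
    refine hh.indicator ?_
    exact (measurableSet_le hh.norm measurable_const).inter
      (measurableSet_le measurable_id.abs measurable_const)
  refine ⟨hm, ?_, n, hb⟩
  have hs : IntegrableOn (trunc n h) (Set.Icc (-(n:ℝ)) n) :=
    IntegrableOn.of_bound (by simp) hm.aestronglyMeasurable n (Eventually.of_forall hb)
  rw [← integrable_indicator_iff measurableSet_Icc] at hs
  refine hs.congr (Eventually.of_forall fun x => ?_)
  rw [Set.indicator_apply]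
  split_ifs with hx
  · rfl
  · rw [trunc, Set.indicator_of_notMem]
    intro h2
    exact hx (abs_le.1 h2.2)

theorem tendsto_trunc (h : ℝ → ℂ) (x : ℝ) : Tendsto (fun n => trunc n h x) atTop (𝓝 (h x)) := by
  apply tendsto_const_nhds.congr'
  obtain ⟨N, hN⟩ := exists_nat_ge (max ‖h x‖ |x|)
  filter_upwards [eventually_ge_atTop N] with n hn
  have hn' : (N : ℝ) ≤ n := by exact_mod_cast hn
  rw [trunc, Set.indicator_of_mem]
  exact ⟨(le_max_left _ _).trans (hN.trans hn'), (le_max_right _ _).trans (hN.trans hn')⟩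

/-- The truncated `L²` functions. -/
def truncL2 (n : ℕ) (f : L2) : L2 :=
  (nice_trunc n (Lp.stronglyMeasurable f).measurable).memLp.toLp (trunc n f)

theorem tendsto_truncL2 (f : L2) : Tendsto (fun n => truncL2 n f) atTop (𝓝 f) := by
  rw [Lp.tendsto_Lp_iff_tendsto_eLpNorm']
  have h := tendsto_eLpNorm_two_of_dominated (g := fun n => trunc n f) (G := f) (b := f)
    (fun n => (nice_trunc n (Lp.stronglyMeasurable f).measurable).measurable.aestronglyMeasurable)
    (Lp.aestronglyMeasurable f) (Lp.memLp f) (fun n => Eventually.of_forall fun x => ?_)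
    (Eventually.of_forall fun x => tendsto_trunc _ x)
  · refine h.congr fun n => ?_
    apply eLpNorm_congr_ae
    filter_upwards [(nice_trunc n (Lp.stronglyMeasurable f).measurable).memLp.coeFn_toLp] with x hx
    rw [Pi.sub_apply, Pi.sub_apply, truncL2, hx]
  · rw [trunc, Set.indicator_apply]
    split_ifs <;> simp

instance fact_one_le_four : Fact ((1 : ℝ≥0∞) ≤ 4) := ⟨by norm_num⟩

instance holderTriple_four_four_two : ENNReal.HolderTriple 4 4 2 where
  inv_add_inv_eq_inv := by
    rw [← ENNReal.toReal_eq_toReal_iff' (by simp) (by simp), ENNReal.toReal_add (by simp) (by simp)]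
    simp
    norm_num

/-- The Lipschitz constant of the space-time lift. -/
def liftConst : ℝ := (formConst ^ (1 / 4 : ℝ)).toReal

theorem liftConst_nonneg : 0 ≤ liftConst := ENNReal.toReal_nonneg

theorem norm_toLp_evo_le {h : ℝ → ℂ} (hh : Nice h) :
    ‖(memLp_evo hh).toLp (fun p : ℝ × ℝ => evo h p.1 p.2)‖ ≤ liftConst * ‖hh.memLp.toLp h‖ := by
  rw [Lp.norm_toLp, Lp.norm_toLp, liftConst, ← ENNReal.toReal_mul]
  apply ENNReal.toReal_mono _ (eLpNorm_evo_le hh)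
  exact ENNReal.mul_ne_top (ENNReal.rpow_ne_top_of_nonneg (by norm_num) formConst_lt_top.ne)
    hh.memLp.eLpNorm_ne_top

theorem norm_toLp_evo_sub_le {h g : ℝ → ℂ} (hh : Nice h) (hg : Nice g) :
    ‖(memLp_evo hh).toLp (fun p : ℝ × ℝ => evo h p.1 p.2) -
      (memLp_evo hg).toLp (fun p : ℝ × ℝ => evo g p.1 p.2)‖ ≤
      liftConst * ‖hh.memLp.toLp h - hg.memLp.toLp g‖ := by
  have h1 := norm_toLp_evo_le (hh.sub hg)
  rw [← MemLp.toLp_sub, ← MemLp.toLp_sub]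
  have e : (fun p : ℝ × ℝ => evo (fun y => h y - g y) p.1 p.2) =
    (fun p : ℝ × ℝ => evo h p.1 p.2) - fun p : ℝ × ℝ => evo g p.1 p.2 := by
    ext p; exact evo_sub hh hg _ _
  simp only [e] at h1
  exact h1

/-- Every `L²` function has a jointly measurable space-time evolution in `L⁴`. -/
theorem exists_lift (f : L2) : ∃ G : Lp ℂ 4 spaceTime, ‖G‖ ≤ liftConst * ‖f‖ ∧
    ∀ᵐ r ∂(volume.restrict (Set.Ioc (0:ℝ) 1)), ∀ᵐ x, G (r, x) = T r f x := by
  have hn : ∀ n, Nice (trunc n (𝓕 f : L2)) := fun n =>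
    nice_trunc n (Lp.stronglyMeasurable _).measurable
  set H : ℕ → L2 := fun n => truncL2 n (𝓕 f) with hH
  have hHlim : Tendsto H atTop (𝓝 (𝓕 f)) := tendsto_truncL2 _
  set g : ℕ → Lp ℂ 4 spaceTime := fun n =>
    (memLp_evo (hn n)).toLp (fun p : ℝ × ℝ => evo (trunc n (𝓕 f : L2)) p.1 p.2) with hg
  have hgd : ∀ n m, dist (g n) (g m) ≤ liftConst * dist (H n) (H m) := by
    intro n m
    rw [dist_eq_norm, dist_eq_norm]
    exact norm_toLp_evo_sub_le (hn n) (hn m)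
  have hgc : CauchySeq g := by
    have hc := hHlim.cauchySeq
    rw [Metric.cauchySeq_iff] at hc ⊢
    intro ε hε
    -- The added `1` avoids dividing by a possibly zero constant.
    obtain ⟨N, hN⟩ := hc (ε / (liftConst + 1)) (div_pos hε (by linarith [liftConst_nonneg]))
    refine ⟨N, fun m hm n hn' => (hgd m n).trans_lt ?_⟩
    have := hN m hm n hn'
    rw [lt_div_iff₀ (by linarith [liftConst_nonneg])] at this
    nlinarith [dist_nonneg (x := H m) (y := H n)]
  obtain ⟨G, hG⟩ := cauchySeq_tendsto_of_complete hgc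
  refine ⟨G, ?_, ?_⟩
  · have h1 := le_of_tendsto_of_tendsto' hG.norm (hHlim.norm.const_mul liftConst)
      fun n => norm_toLp_evo_le (hn n)
    rwa [Lp.norm_fourier_eq] at h1
  -- To identify the slices of `G`, take a subsequence converging a.e. on space-time. For almost
  -- every `r`, the slices also converge to `T r f` in `L²`, hence a.e. along a further subsequence,
  -- and limits agree.
  · obtain ⟨ns, hns, hae⟩ := (tendstoInMeasure_of_tendsto_Lp hG).exists_seq_tendsto_ae
    have hae2 : ∀ᵐ p ∂spaceTime, Tendsto (fun k => evo (trunc (ns k) (𝓕 f : L2)) p.1 p.2) atTop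
        (𝓝 (G p)) := by
      have hall : ∀ᵐ p ∂spaceTime, ∀ n, g n p = evo (trunc n (𝓕 f : L2)) p.1 p.2 := by
        rw [ae_all_iff]
        exact fun n => (memLp_evo (hn n)).coeFn_toLp
      filter_upwards [hae, hall] with p hp1 hp2
      exact hp1.congr fun k => hp2 _
    filter_upwards [Measure.ae_ae_of_ae_prod hae2] with r hr
    have hTlim : Tendsto (fun n => T r (𝓕⁻ (H n) : L2)) atTop (𝓝 (T r f)) := by
      rw [tendsto_iff_norm_sub_tendsto_zero] at hHlim ⊢
      refine hHlim.congr fun n => ?_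
      rw [← T_sub, norm_T, ← Lp.norm_fourier_eq ((𝓕⁻ (H n) : L2) - f), fourier_sub_L2,
        FourierTransform.fourier_fourierInv_eq]
    obtain ⟨ms, hms, hae3⟩ :=
      (tendstoInMeasure_of_tendsto_Lp (hTlim.comp hns.tendsto_atTop)).exists_seq_tendsto_ae
    have hall : ∀ᵐ x, ∀ n, T r (𝓕⁻ (H n) : L2) x = evo (trunc n (𝓕 f : L2)) r x := by
      rw [ae_all_iff]
      exact fun n => T_ae_eq_evo (hn n) r
    filter_upwards [hr, hae3, hall] with x hx1 hx2 hx3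
    refine tendsto_nhds_unique (hx1.comp hms.tendsto_atTop) (hx2.congr fun k => ?_)
    exact hx3 _

/-- The space-time lift `f ↦ ((r, x) ↦ T_r f(x))`. -/
def lift (f : L2) : Lp ℂ 4 spaceTime := (exists_lift f).choose

theorem norm_lift_le (f : L2) : ‖lift f‖ ≤ liftConst * ‖f‖ := (exists_lift f).choose_spec.1

theorem lift_slice (f : L2) :
    ∀ᵐ r ∂(volume.restrict (Set.Ioc (0:ℝ) 1)), ∀ᵐ x, lift f (r, x) = T r f x :=
  (exists_lift f).choose_spec.2

/-- Lifts are obtained by choice; as their slices determine them, the choice is unique and `lift`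
respects differences. -/
theorem ext_of_slices {F G : Lp ℂ 4 spaceTime}
    (h : ∀ᵐ r ∂(volume.restrict (Set.Ioc (0:ℝ) 1)), ∀ᵐ x, F (r, x) = G (r, x)) : F = G := by
  apply Lp.ext
  have hs : MeasurableSet {p | F p = G p} :=
    measurableSet_eq_fun (Lp.stronglyMeasurable F).measurable (Lp.stronglyMeasurable G).measurable
  exact (Measure.ae_prod_mem_iff_ae_ae_mem hs).2 h

theorem lift_sub (f g : L2) : lift (f - g) = lift f - lift g := by
  apply ext_of_slices
  have h4 := Measure.ae_ae_of_ae_prod (Lp.coeFn_sub (lift f) (lift g))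
  filter_upwards [lift_slice f, lift_slice g, lift_slice (f - g), h4] with r h1 h2 h3 h4
  filter_upwards [h1, h2, h3, h4, Lp.coeFn_sub (T r f) (T r g)] with x k1 k2 k3 k4 k5
  rw [k3, k4, Pi.sub_apply, k1, k2, T_sub, k5, Pi.sub_apply]

theorem continuous_lift : Continuous lift := by
  have : LipschitzWith (Real.toNNReal liftConst) lift := by
    apply LipschitzWith.of_dist_le_mul
    intro f g
    rw [dist_eq_norm, dist_eq_norm, ← lift_sub, Real.coe_toNNReal _ liftConst_nonneg]
    exact norm_lift_le _
  exact this.continuous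

/-- The pointwise product `L⁴ × L⁴ → L²` on space-time. -/
def mulL4 : Lp ℂ 4 spaceTime →L[ℂ] Lp ℂ 4 spaceTime →L[ℂ] Lp ℂ 2 spaceTime :=
  (ContinuousLinearMap.mul ℂ ℂ).holderL spaceTime 4 4 2

theorem coeFn_mulL4 (F G : Lp ℂ 4 spaceTime) :
    (mulL4 F G : ℝ × ℝ → ℂ) =ᵐ[spaceTime] fun p => F p * G p :=
  ContinuousLinearMap.coeFn_holder (r := 2) (ContinuousLinearMap.mul ℂ ℂ) F G

/-- Grouping the conjugated slots 1, 3 against 2, 4 makes the form an `L²` inner product of products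
of `L⁴` functions. Fubini then yields the integrability in `r` as well, which the exhaustion of `(0,
1]` on the physical side requires. -/
theorem integrable_slice_and_eq (f₁ f₂ f₃ f₄ : L2) :
    IntegrableOn (fun r => ∫ x : ℝ,
      (starRingEnd ℂ) (T r f₁ x) * T r f₂ x * (starRingEnd ℂ) (T r f₃ x) * T r f₄ x)
      (Set.Ioc (0:ℝ) 1) ∧
    ∫ r in Set.Ioc (0:ℝ) 1, ∫ x : ℝ,
      (starRingEnd ℂ) (T r f₁ x) * T r f₂ x * (starRingEnd ℂ) (T r f₃ x) * T r f₄ x =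
    inner ℂ (mulL4 (lift f₁) (lift f₃)) (mulL4 (lift f₂) (lift f₄)) := by
  have hi := L2.integrable_inner (𝕜 := ℂ) (mulL4 (lift f₁) (lift f₃)) (mulL4 (lift f₂) (lift f₄))
  have hs : ∀ᵐ r ∂(volume.restrict (Set.Ioc (0:ℝ) 1)),
      ∫ x, inner ℂ (mulL4 (lift f₁) (lift f₃) (r, x)) (mulL4 (lift f₂) (lift f₄) (r, x)) =
      ∫ x : ℝ, (starRingEnd ℂ) (T r f₁ x) * T r f₂ x * (starRingEnd ℂ) (T r f₃ x) * T r f₄ x := by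
    filter_upwards [lift_slice f₁, lift_slice f₂, lift_slice f₃, lift_slice f₄,
      Measure.ae_ae_of_ae_prod (coeFn_mulL4 (lift f₁) (lift f₃)),
      Measure.ae_ae_of_ae_prod (coeFn_mulL4 (lift f₂) (lift f₄))] with r h1 h2 h3 h4 h5 h6
    apply integral_congr_ae
    filter_upwards [h1, h2, h3, h4, h5, h6] with x k1 k2 k3 k4 k5 k6
    rw [k5, k6, RCLike.inner_apply, k1, k2, k3, k4, map_mul]
    ring
  constructor
  · exact hi.integral_prod_left.congr hs
  · rw [L2.inner_def]
    exact (integral_congr_ae (hs.mono fun r hr => hr.symm)).trans (integral_prod _ hi).symm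

theorem Q4_eq_inner (f₁ f₂ f₃ f₄ : L2) :
    Q4 f₁ f₂ f₃ f₄ = inner ℂ (mulL4 (lift f₁) (lift f₃)) (mulL4 (lift f₂) (lift f₄)) := by
  rw [Q4, intervalIntegral.integral_of_le zero_le_one]
  exact (integrable_slice_and_eq f₁ f₂ f₃ f₄).2

theorem continuous_Q4 : Continuous fun p : L2 × L2 × L2 × L2 => Q4 p.1 p.2.1 p.2.2.1 p.2.2.2 := by
  simp_rw [Q4_eq_inner]
  have := continuous_lift
  fun_prop

theorem absForm_mono {u₁ u₂ u₃ u₄ v₁ v₂ v₃ v₄ : ℝ → ℝ≥0∞} (h₁ : u₁ ≤ v₁) (h₂ : u₂ ≤ v₂)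
    (h₃ : u₃ ≤ v₃) (h₄ : u₄ ≤ v₄) : absForm u₁ u₂ u₃ u₄ ≤ absForm v₁ v₂ v₃ v₄ := by
  apply lintegral_mono
  intro p
  simp only [resProd]
  gcongr
  · exact h₁ _
  · exact h₂ _
  · exact h₃ _
  · exact h₄ _

/-- Pass a bound for truncations of `f` on the `V` side to all of `L²`. -/
theorem enorm_Q4_le_of_trunc {V : L2 → L2} {U : L2 → L2} (hU : Continuous U)
    (hUV : ∀ f, U (V f) = f) {C : ℝ≥0∞}
    (h : ∀ (n : ℕ) (f₁ f₂ f₃ f₄ : L2),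
      ‖Q4 (U (truncL2 n f₁)) (U (truncL2 n f₂)) (U (truncL2 n f₃)) (U (truncL2 n f₄))‖ₑ ≤
      C * absForm (fun x => ‖trunc n f₁ x‖ₑ) (fun x => ‖trunc n f₂ x‖ₑ) (fun x => ‖trunc n f₃ x‖ₑ)
        (fun x => ‖trunc n f₄ x‖ₑ)) (f₁ f₂ f₃ f₄ : L2) :
    ‖Q4 f₁ f₂ f₃ f₄‖ₑ ≤ C * absForm (fun x => ‖V f₁ x‖ₑ) (fun x => ‖V f₂ x‖ₑ)
      (fun x => ‖V f₃ x‖ₑ) (fun x => ‖V f₄ x‖ₑ) := by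
  have hl : ∀ f, Tendsto (fun n => U (truncL2 n (V f))) atTop (𝓝 f) := by
    intro f
    have := (hU.tendsto (V f)).comp (tendsto_truncL2 (V f))
    rwa [hUV] at this
  have hQ := ((continuous_Q4.tendsto (f₁, f₂, f₃, f₄)).comp
    ((hl f₁).prodMk_nhds ((hl f₂).prodMk_nhds ((hl f₃).prodMk_nhds (hl f₄))))).enorm
  refine le_of_tendsto' hQ fun n => (h n (V f₁) (V f₂) (V f₃) (V f₄)).trans ?_
  gcongr
  apply absForm_mono <;> exact fun x => enorm_trunc_le _ _ _

/-! ### The quadrilinear bound on the Fourier side -/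

/-- The master estimate on the Fourier side. -/
theorem enorm_Q4_le_fourier (f₁ f₂ f₃ f₄ : L2) :
    ‖Q4 f₁ f₂ f₃ f₄‖ₑ ≤ 1 * absForm (fun x => ‖(𝓕 f₁ : L2) x‖ₑ) (fun x => ‖(𝓕 f₂ : L2) x‖ₑ)
      (fun x => ‖(𝓕 f₃ : L2) x‖ₑ) (fun x => ‖(𝓕 f₄ : L2) x‖ₑ) := by
  refine enorm_Q4_le_of_trunc (V := fun f => 𝓕 f) (U := fun f => 𝓕⁻ f)
    (Lp.fourierTransformₗᵢ ℝ ℂ).symm.continuous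
    (fun f => FourierTransform.fourierInv_fourier_eq f) ?_ f₁ f₂ f₃ f₄
  intro n f₁ f₂ f₃ f₄
  have hn : ∀ f : L2, Nice (trunc n f) := fun f => nice_trunc n (Lp.stronglyMeasurable f).measurable
  rw [one_mul]
  refine le_trans (le_of_eq ?_) (enorm_integral_evo_four_le (hn f₁) (hn f₂) (hn f₃) (hn f₄))
  rw [Q4, intervalIntegral.integral_of_le zero_le_one]
  congr 1
  apply integral_congr_ae
  filter_upwards with r
  apply integral_congr_ae
  filter_upwards [T_ae_eq_evo (hn f₁) r, T_ae_eq_evo (hn f₂) r, T_ae_eq_evo (hn f₃) r,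
    T_ae_eq_evo (hn f₄) r] with x h1 h2 h3 h4
  rw [truncL2, truncL2, truncL2, truncL2, h1, h2, h3, h4]

/-! ### The free evolution on the physical side -/

/-- The complex Gaussian width `4π(ε + ir)`. -/
def width (r ε : ℝ) : ℂ := 4 * π * (ε + r * Complex.I)

theorem width_re (r ε : ℝ) : (width r ε).re = 4 * π * ε := by
  simp [width]

theorem width_im (r ε : ℝ) : (width r ε).im = 4 * π * r := by
  simp [width]

theorem width_mem_slitPlane {r : ℝ} (hr : 0 < r) (ε : ℝ) : width r ε ∈ Complex.slitPlane := by
  right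
  rw [width_im]
  positivity

/-- Since `b` has positive real part, the multiplier is integrable, so Fubini applies and the inner
integral is the transform of a Gaussian. -/
theorem fourierInv_gaussian_mul_fourier {h : ℝ → ℂ} (hh : Nice h) {b : ℂ} (hb : 0 < b.re) (x : ℝ) :
    𝓕⁻ (fun ξ : ℝ => Complex.exp (-π * b * ξ ^ 2) * 𝓕 h ξ) x =
      ∫ y : ℝ, (1 / b ^ (1 / 2 : ℂ) * Complex.exp (-π / b * ((x - y : ℝ) : ℂ) ^ 2)) * h y := by
  have hgi : Integrable fun ξ : ℝ => Complex.exp (-π * b * ξ ^ 2) := by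
    have := integrable_cexp_neg_mul_sq (b := π * b) (by simpa using mul_pos Real.pi_pos hb)
    simpa only [neg_mul] using this
  have hfg : ∀ u : ℝ, ∫ ξ : ℝ, Complex.exp (2 * π * u * ξ * Complex.I) *
      Complex.exp (-π * b * ξ ^ 2) = 1 / b ^ (1 / 2 : ℂ) * Complex.exp (-π / b * (u : ℂ) ^ 2) := by
    intro u
    rw [← fourierInv_real_eq, Real.fourierInv_eq_fourier_neg, fourier_gaussian_pi hb]
    simp
  rw [fourierInv_real_eq]
  have e1 : ∀ ξ : ℝ, 𝓕 h ξ = ∫ y : ℝ, Complex.exp (-(2 * π * y * ξ * Complex.I)) * h y := by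
    intro ξ
    rw [Real.fourier_eq']
    congr 1; ext y
    rw [smul_eq_mul]
    congr 2
    simp only [RCLike.inner_apply, conj_trivial]
    push_cast; ring
  have hi : Integrable (Function.uncurry fun ξ y : ℝ => Complex.exp (2 * π * x * ξ * Complex.I) *
      Complex.exp (-(2 * π * y * ξ * Complex.I)) * (Complex.exp (-π * b * ξ ^ 2) * h y)) := by
    refine (hgi.mul_prod hh.integrable).bdd_mul (c := 1) (by fun_prop)
      (Eventually.of_forall fun p => ?_)
    rw [← Complex.exp_add, show (2 * π * x * p.1 * Complex.I + -(2 * π * p.2 * p.1 * Complex.I) : ℂ)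
      = ((2 * π * x * p.1 - 2 * π * p.2 * p.1 : ℝ) : ℂ) * Complex.I by push_cast; ring,
      Complex.norm_exp_ofReal_mul_I]
  calc ∫ ξ : ℝ, Complex.exp (2 * π * x * ξ * Complex.I) * (Complex.exp (-π * b * ξ ^ 2) * 𝓕 h ξ)
      = ∫ ξ : ℝ, ∫ y : ℝ, Complex.exp (2 * π * x * ξ * Complex.I) *
        Complex.exp (-(2 * π * y * ξ * Complex.I)) * (Complex.exp (-π * b * ξ ^ 2) * h y) := by
        congr 1; ext ξ
        rw [e1, ← mul_assoc, ← integral_const_mul]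
        congr 1; ext y; ring
    _ = ∫ y : ℝ, ∫ ξ : ℝ, Complex.exp (2 * π * x * ξ * Complex.I) *
        Complex.exp (-(2 * π * y * ξ * Complex.I)) * (Complex.exp (-π * b * ξ ^ 2) * h y) :=
        integral_integral_swap hi
    _ = _ := by
        congr 1; ext y
        rw [← hfg (x - y), ← integral_mul_const]
        congr 1; ext ξ
        rw [← Complex.exp_add, ← mul_assoc]
        congr 3
        push_cast; ring

theorem norm_exp_neg_pi_width {r ε : ℝ} (hε : 0 ≤ ε) (ξ : ℝ) :
    ‖Complex.exp (-π * width r ε * ξ ^ 2)‖ ≤ 1 := by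
  rw [Complex.norm_exp, Real.exp_le_one_iff]
  have : (-π * width r ε * (ξ : ℂ) ^ 2 : ℂ).re = -(π * (4 * π * ε) * ξ ^ 2) := by
    rw [show (-π * width r ε * (ξ : ℂ) ^ 2 : ℂ) = ((-(π * ξ ^ 2) : ℝ) : ℂ) * width r ε by
      push_cast; ring, Complex.re_ofReal_mul, width_re]
    ring
  rw [this]
  have := Real.pi_pos
  have : 0 ≤ π * (4 * π * ε) * ξ ^ 2 := by positivity
  linarith

theorem exp_neg_pi_width_zero (r ξ : ℝ) :
    Complex.exp (-π * width r 0 * ξ ^ 2) = schrodingerSymbol r ξ := by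
  rw [schrodingerSymbol, width]
  congr 1; push_cast; ring

/-- The free evolution of nice data as an oscillatory integral operator. -/
theorem T_ae_eq_kernel {h : ℝ → ℂ} (hh : Nice h) {r : ℝ} (hr : 0 < r) :
    (T r (hh.memLp.toLp h) : ℝ → ℂ) =ᵐ[volume] fun x => ∫ y : ℝ,
      (1 / (width r 0) ^ (1 / 2 : ℂ) *
        Complex.exp (-π / width r 0 * ((x - y : ℝ) : ℂ) ^ 2)) * h y := by
  set f : L2 := hh.memLp.toLp h with hf
  have hFf : ((𝓕 f : L2) : ℝ → ℂ) =ᵐ[volume] 𝓕 h := fourier_toLp_ae_eq hh.integrable hh.memLp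
  have hFc := continuous_fourier_of_integrable hh.integrable
  have hF2 : MemLp (𝓕 h) 2 volume := (memLp_congr_ae hFf).1 (Lp.memLp _)
  -- The Schrödinger multiplier is not integrable; it is the limit of the damped multipliers with
  -- width `4π(ε + ir)`. Both sides of the Gaussian formula are passed to the limit, one in `L²` and
  -- the other pointwise.
  set ε : ℕ → ℝ := fun n => 1 / ((n : ℝ) + 1) with hε
  have hεpos : ∀ n, 0 < ε n := fun n => by positivity
  have hεlim : Tendsto ε atTop (𝓝 0) := tendsto_one_div_add_atTop_nhds_zero_nat
  have hwlim : Tendsto (fun n => width r (ε n)) atTop (𝓝 (width r 0)) := by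
    have : Continuous (width r) := by unfold width; fun_prop
    exact (this.tendsto 0).comp hεlim
  set g : ℕ → ℝ → ℂ := fun n ξ => Complex.exp (-π * width r (ε n) * ξ ^ 2) * 𝓕 h ξ with hg
  have hgm : ∀ n, AEStronglyMeasurable (g n) volume := fun n =>
    (Continuous.mul (by fun_prop) hFc).aestronglyMeasurable
  have hgle : ∀ n ξ, ‖g n ξ‖ ≤ ‖𝓕 h ξ‖ := by
    intro n ξ
    rw [hg]
    simp only [norm_mul]
    calc _ ≤ 1 * ‖𝓕 h ξ‖ := by gcongr; exact norm_exp_neg_pi_width (hεpos n).le ξ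
      _ = _ := one_mul _
  have hg2 : ∀ n, MemLp (g n) 2 volume := fun n =>
    hF2.of_le (hgm n) (Eventually.of_forall (hgle n))
  have hg1 : ∀ n, Integrable (g n) := by
    intro n
    have hgi : Integrable fun ξ : ℝ => Complex.exp (-π * width r (ε n) * ξ ^ 2) := by
      have := integrable_cexp_neg_mul_sq (b := π * width r (ε n)) (by
        rw [Complex.re_ofReal_mul, width_re]
        have := hεpos n
        positivity)
      simpa only [neg_mul] using this
    refine hgi.mul_bdd (c := ∫ y, ‖h y‖) hFc.aestronglyMeasurable (Eventually.of_forall fun ξ => ?_)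
    have := norm_fourierInv_le h (-ξ)
    rwa [Real.fourierInv_eq_fourier_neg, neg_neg] at this
  set S : L2 := (memLp_schrodingerSymbol_mul r (𝓕 f)).toLp
    (fun ξ => schrodingerSymbol r ξ * (𝓕 f : L2) ξ) with hS
  have hSae : (S : ℝ → ℂ) =ᵐ[volume] fun ξ => schrodingerSymbol r ξ * 𝓕 h ξ := by
    filter_upwards [(memLp_schrodingerSymbol_mul r (𝓕 f)).coeFn_toLp, hFf] with ξ h1 h2
    rw [hS, h1, h2]
  have hlim : Tendsto (fun n => (hg2 n).toLp (g n)) atTop (𝓝 S) := by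
    rw [Lp.tendsto_Lp_iff_tendsto_eLpNorm']
    have := tendsto_eLpNorm_two_of_dominated (g := g) (G := S) (b := fun ξ => 2 * 𝓕 h ξ)
      hgm (Lp.aestronglyMeasurable S) (hF2.const_mul 2) (fun n => ?_) ?_
    · refine this.congr fun n => ?_
      apply eLpNorm_congr_ae
      filter_upwards [(hg2 n).coeFn_toLp] with x hx
      rw [Pi.sub_apply, Pi.sub_apply, hx]
    · filter_upwards [hSae] with ξ hξ
      rw [hξ]
      refine (norm_sub_le _ _).trans ?_
      have h2 : ‖2 * 𝓕 h ξ‖ = 2 * ‖𝓕 h ξ‖ := by simp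
      rw [h2, norm_mul (schrodingerSymbol r ξ), norm_schrodingerSymbol, one_mul]
      have := hgle n ξ
      linarith
    · filter_upwards [hSae] with ξ hξ
      rw [hξ, ← exp_neg_pi_width_zero]
      refine Tendsto.mul_const _ ?_
      exact (Complex.continuous_exp.tendsto _).comp ((hwlim.const_mul _).mul_const _)
  have hlim2 : Tendsto (fun n => (𝓕⁻ ((hg2 n).toLp (g n)) : L2)) atTop (𝓝 (T r f)) :=
    ((Lp.fourierTransformₗᵢ ℝ ℂ).symm.continuous.tendsto S).comp hlim
  obtain ⟨ns, hns, hae⟩ := (tendstoInMeasure_of_tendsto_Lp hlim2).exists_seq_tendsto_ae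
  have hall : ∀ᵐ x, ∀ n, (𝓕⁻ ((hg2 n).toLp (g n)) : L2) x = 𝓕⁻ (g n) x := by
    rw [ae_all_iff]
    exact fun n => fourierInv_toLp_ae_eq (hg1 n) (hg2 n)
  filter_upwards [hae, hall] with x hx1 hx2
  refine tendsto_nhds_unique hx1 ?_
  have hpt : Tendsto (fun n => 𝓕⁻ (g n) x) atTop (𝓝 (∫ y : ℝ,
      (1 / (width r 0) ^ (1 / 2 : ℂ) *
        Complex.exp (-π / width r 0 * ((x - y : ℝ) : ℂ) ^ 2)) * h y)) := by
    have e : ∀ n, 𝓕⁻ (g n) x = ∫ y : ℝ, (1 / (width r (ε n)) ^ (1 / 2 : ℂ) *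
        Complex.exp (-π / width r (ε n) * ((x - y : ℝ) : ℂ) ^ 2)) * h y := fun n =>
      fourierInv_gaussian_mul_fourier hh (by
        rw [width_re]
        have := hεpos n
        positivity) x
    simp_rw [e]
    have hw0 : width r 0 ≠ 0 := Complex.slitPlane_ne_zero (width_mem_slitPlane hr 0)
    have hpow0 : (width r 0) ^ (1 / 2 : ℂ) ≠ 0 := by
      rw [Complex.cpow_ne_zero_iff]; exact Or.inl hw0
    -- The principal square root is continuous at the limit because `4πir` with `r > 0` lies in the
    -- slit plane.
    have hclim : Tendsto (fun n => 1 / (width r (ε n)) ^ (1 / 2 : ℂ)) atTop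
        (𝓝 (1 / (width r 0) ^ (1 / 2 : ℂ))) :=
      tendsto_const_nhds.div (((continuousAt_id.cpow continuousAt_const
        (width_mem_slitPlane hr 0)).tendsto).comp hwlim) hpow0
    obtain ⟨M, hM⟩ := hclim.norm.bddAbove_range
    refine tendsto_integral_of_dominated_convergence (fun y => M * ‖h y‖) (fun n => ?_)
      (hh.integrable.norm.const_mul M) (fun n => Eventually.of_forall fun y => ?_)
      (Eventually.of_forall fun y => ?_)
    · exact (Continuous.aestronglyMeasurable (by fun_prop)).mul hh.integrable.aestronglyMeasurable
    · rw [norm_mul, norm_mul]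
      gcongr
      have h1 : ‖1 / (width r (ε n)) ^ (1 / 2 : ℂ)‖ ≤ M := hM ⟨n, rfl⟩
      have h2 : ‖Complex.exp (-π / width r (ε n) * ((x - y : ℝ) : ℂ) ^ 2)‖ ≤ 1 := by
        rw [Complex.norm_exp, Real.exp_le_one_iff]
        rw [show (-π / width r (ε n) * ((x - y : ℝ) : ℂ) ^ 2 : ℂ) =
          ((-(π * (x - y) ^ 2) : ℝ) : ℂ) * (width r (ε n))⁻¹ by push_cast; ring,
          Complex.re_ofReal_mul, Complex.inv_re, width_re]
        have := hεpos n
        have h3 : 0 ≤ (4 * π * ε n) / Complex.normSq (width r (ε n)) :=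
          div_nonneg (by positivity) (Complex.normSq_nonneg _)
        have h4 : 0 ≤ π * (x - y) ^ 2 := by positivity
        nlinarith [mul_nonneg h4 h3]
      calc _ ≤ M * 1 := by
            gcongr
            exact (norm_nonneg _).trans h1
        _ = M := mul_one M
    · refine Tendsto.mul_const _ (hclim.mul ?_)
      exact (Complex.continuous_exp.tendsto _).comp
        ((tendsto_const_nhds.div hwlim hw0).mul_const _)
  exact (hpt.comp hns.tendsto_atTop).congr fun k => (hx2 _).symm

/-- The free evolution as a rescaled chirped Fourier transform. -/
theorem T_ae_eq_chirp {h : ℝ → ℂ} (hh : Nice h) {r : ℝ} (hr : 0 < r) :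
    (T r (hh.memLp.toLp h) : ℝ → ℂ) =ᵐ[volume] fun x =>
      (1 / (width r 0) ^ (1 / 2 : ℂ) * chirp (1 / (4 * r)) x) *
        𝓕⁻ (fun y => chirp (1 / (4 * r)) y * h y) ((-(4 * π * r)⁻¹) * x) := by
  filter_upwards [T_ae_eq_kernel hh hr] with x hx
  rw [hx, fourierInv_real_eq, ← integral_const_mul]
  congr 1; ext y
  have hr' : (r : ℂ) ≠ 0 := by exact_mod_cast hr.ne'
  have hpi : (π : ℂ) ≠ 0 := by exact_mod_cast Real.pi_ne_zero
  -- The exponent equals `i(x-y)²/(4r)`. Its squares are the two chirps, and the cross term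
  -- `-ixy/(2r)` is the inverse Fourier phase at `-x/(4πr)`.
  have : Complex.exp (-π / width r 0 * ((x - y : ℝ) : ℂ) ^ 2) = chirp (1 / (4 * r)) x *
      (Complex.exp (2 * π * ((-(4 * π * r)⁻¹ * x : ℝ) : ℂ) * y * Complex.I) *
        chirp (1 / (4 * r)) y) := by
    rw [chirp, chirp, ← Complex.exp_add, ← Complex.exp_add]
    congr 1
    rw [width]
    push_cast
    field_simp
    rw [zero_add]
    field_simp
    ring_nf
    simp only [Complex.I_sq]
    ring
  rw [this]; ring

theorem norm_width_factor {r : ℝ} (hr : 0 < r) (x : ℝ) :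
    ‖1 / (width r 0) ^ (1 / 2 : ℂ) * chirp (1 / (4 * r)) x‖ ^ 4 = ((4 * π * r) ^ 2)⁻¹ := by
  have hw : ‖width r 0‖ = 4 * π * r := by
    rw [width]
    simp [abs_of_pos hr, abs_of_pos Real.pi_pos, mul_assoc]
  have hhalf : ‖(width r 0) ^ (1 / 2 : ℂ)‖ = (4 * π * r) ^ (1 / 2 : ℝ) := by
    rw [show (1 / 2 : ℂ) = ((1 / 2 : ℝ) : ℂ) by push_cast; rfl, Complex.norm_cpow_real, hw]
  rw [norm_mul, norm_chirp, mul_one, norm_div, norm_one, hhalf, div_pow, one_pow, one_div,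
    ← Real.rpow_natCast, ← Real.rpow_mul (by positivity), ← Real.rpow_natCast]
  norm_num

/-- The outer chirps cancel between conjugated and unconjugated factors. The four prefactors give
`(4πr)^{-2}` and the rescaling of `x` returns `4πr`. -/
theorem integral_T_four_eq {h₁ h₂ h₃ h₄ : ℝ → ℂ} (n₁ : Nice h₁) (n₂ : Nice h₂)
    (n₃ : Nice h₃) (n₄ : Nice h₄) {r : ℝ} (hr : 0 < r) :
    ∫ x : ℝ, (starRingEnd ℂ) (T r (n₁.memLp.toLp h₁) x) * T r (n₂.memLp.toLp h₂) x *
      (starRingEnd ℂ) (T r (n₃.memLp.toLp h₃) x) * T r (n₄.memLp.toLp h₄) x =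
    (((4 * π * r)⁻¹ : ℝ) : ℂ) * ∫ x, (starRingEnd ℂ) (𝓕⁻ (fun y => chirp (1 / (4 * r)) y * h₁ y) x) *
        𝓕⁻ (fun y => chirp (1 / (4 * r)) y * h₂ y) x *
        (starRingEnd ℂ) (𝓕⁻ (fun y => chirp (1 / (4 * r)) y * h₃ y) x) *
        𝓕⁻ (fun y => chirp (1 / (4 * r)) y * h₄ y) x := by
  set W : ℝ → ℂ := fun x => (starRingEnd ℂ) (𝓕⁻ (fun y => chirp (1 / (4 * r)) y * h₁ y) x) *
        𝓕⁻ (fun y => chirp (1 / (4 * r)) y * h₂ y) x *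
        (starRingEnd ℂ) (𝓕⁻ (fun y => chirp (1 / (4 * r)) y * h₃ y) x) *
        𝓕⁻ (fun y => chirp (1 / (4 * r)) y * h₄ y) x with hW
  have e : ∫ x : ℝ, (starRingEnd ℂ) (T r (n₁.memLp.toLp h₁) x) * T r (n₂.memLp.toLp h₂) x *
      (starRingEnd ℂ) (T r (n₃.memLp.toLp h₃) x) * T r (n₄.memLp.toLp h₄) x =
      ∫ x : ℝ, ((((4 * π * r) ^ 2)⁻¹ : ℝ) : ℂ) * W (-(4 * π * r)⁻¹ * x) := by
    apply integral_congr_ae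
    filter_upwards [T_ae_eq_chirp n₁ hr, T_ae_eq_chirp n₂ hr, T_ae_eq_chirp n₃ hr,
      T_ae_eq_chirp n₄ hr] with x k1 k2 k3 k4
    rw [k1, k2, k3, k4, ← norm_width_factor hr x, hW]
    set c := 1 / (width r 0) ^ (1 / 2 : ℂ) * chirp (1 / (4 * r)) x with hc
    have hc4 : ((‖c‖ ^ 4 : ℝ) : ℂ) = ((starRingEnd ℂ) c * c) * ((starRingEnd ℂ) c * c) := by
      rw [← Complex.normSq_eq_conj_mul_self, Complex.normSq_eq_norm_sq]
      push_cast; ring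
    rw [hc4]
    simp only [map_mul]
    ring
  rw [e, integral_const_mul, Measure.integral_comp_mul_left]
  rw [Complex.real_smul, ← mul_assoc, ← Complex.ofReal_mul]
  congr 2
  rw [inv_neg, inv_inv, abs_neg, abs_of_pos (by positivity)]
  have : (4 * π * r) ≠ 0 := by positivity
  field_simp

/-! ### The oscillatory integral in `1/r` and the bound on the physical side -/

/-- Integration by parts: the derivative of `r e^{-iλ/r}` is `e^{-iλ/r} + iλ r⁻¹ e^{-iλ/r}`. The
boundary terms cost `δ + ε` and the remaining integral `δ - ε`. -/
theorem norm_integral_osc_le {lam ε δ : ℝ} (hl : lam ≠ 0) (hε : 0 < ε) (hεδ : ε ≤ δ) :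
    ‖∫ r in ε..δ, ((r⁻¹ : ℝ) : ℂ) * Complex.exp ((-(lam / r) : ℝ) * Complex.I)‖ ≤ 2 * δ / |lam| := by
  have hpos : ∀ r ∈ Set.uIcc ε δ, 0 < r := fun r hr => by
    rw [Set.uIcc_of_le hεδ] at hr; exact hε.trans_le hr.1
  have hcont : ContinuousOn (fun r : ℝ => Complex.exp ((-(lam / r) : ℝ) * Complex.I)) (Set.uIcc ε δ) := by
    have : ContinuousOn (fun r : ℝ => -(lam / r)) (Set.uIcc ε δ) :=
      (continuousOn_const.div continuousOn_id fun r hr => (hpos r hr).ne').neg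
    exact Complex.continuous_exp.comp_continuousOn
      ((Complex.continuous_ofReal.comp_continuousOn this).mul continuousOn_const)
  have hcont2 : ContinuousOn (fun r : ℝ => ((r⁻¹ : ℝ) : ℂ) *
      Complex.exp ((-(lam / r) : ℝ) * Complex.I)) (Set.uIcc ε δ) :=
    (Complex.continuous_ofReal.comp_continuousOn
      (continuousOn_inv₀.mono fun r hr => (hpos r hr).ne')).mul hcont
  have hd : ∀ r ∈ Set.uIcc ε δ, HasDerivAt (fun r : ℝ => (r : ℂ) *
      Complex.exp ((-(lam / r) : ℝ) * Complex.I))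
      (Complex.exp ((-(lam / r) : ℝ) * Complex.I) + (lam * Complex.I) *
        (((r⁻¹ : ℝ) : ℂ) * Complex.exp ((-(lam / r) : ℝ) * Complex.I))) r := by
    intro r hr
    have hr0 := (hpos r hr).ne'
    have h1 : HasDerivAt (fun r : ℝ => -(lam / r)) (lam / r ^ 2) r := by
      refine ((hasDerivAt_const r lam).fun_div (hasDerivAt_id r) hr0).fun_neg.congr_deriv ?_
      simp [neg_div]
    have h2 := ((h1.ofReal_comp).mul_const Complex.I).cexp
    have h3 := (hasDerivAt_id r).ofReal_comp.mul h2
    refine h3.congr_deriv ?_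
    have : (r : ℂ) ≠ 0 := by exact_mod_cast hr0
    push_cast
    simp only [id]
    field_simp
  have hftc := intervalIntegral.integral_eq_sub_of_hasDerivAt hd
    ((hcont.add (continuousOn_const.mul hcont2)).intervalIntegrable)
  have hint2 : IntervalIntegrable (fun r : ℝ => (lam * Complex.I) * (((r⁻¹ : ℝ) : ℂ) *
      Complex.exp ((-(lam / r) : ℝ) * Complex.I))) volume ε δ :=
    (continuousOn_const.mul hcont2).intervalIntegrable
  rw [intervalIntegral.integral_add hcont.intervalIntegrable hint2,
    intervalIntegral.integral_const_mul] at hftc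
  have hn : ∀ r : ℝ, ‖Complex.exp ((-(lam / r) : ℝ) * Complex.I)‖ = 1 := fun r =>
    Complex.norm_exp_ofReal_mul_I _
  have hb : ‖∫ r in ε..δ, Complex.exp ((-(lam / r) : ℝ) * Complex.I)‖ ≤ δ - ε := by
    have := intervalIntegral.norm_integral_le_of_norm_le_const (a := ε) (b := δ) (C := 1)
      (f := fun r : ℝ => Complex.exp ((-(lam / r) : ℝ) * Complex.I)) fun r _ => (hn r).le
    rwa [one_mul, abs_of_nonneg (sub_nonneg.2 hεδ)] at this
  rw [le_div_iff₀ (abs_pos.2 hl), mul_comm]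
  have hmul : |lam| * ‖∫ r in ε..δ, ((r⁻¹ : ℝ) : ℂ) * Complex.exp ((-(lam / r) : ℝ) * Complex.I)‖ =
      ‖(lam * Complex.I) * ∫ r in ε..δ, ((r⁻¹ : ℝ) : ℂ) *
        Complex.exp ((-(lam / r) : ℝ) * Complex.I)‖ := by
    rw [norm_mul, norm_mul, Complex.norm_I, mul_one, Complex.norm_real, Real.norm_eq_abs]
  rw [hmul, eq_sub_of_add_eq' hftc]
  refine (norm_sub_le _ _).trans ?_
  have h5 : ‖(δ : ℂ) * Complex.exp ((-(lam / δ) : ℝ) * Complex.I) -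
      (ε : ℂ) * Complex.exp ((-(lam / ε) : ℝ) * Complex.I)‖ ≤ δ + ε := by
    refine (norm_sub_le _ _).trans ?_
    rw [norm_mul, norm_mul, hn, hn, mul_one, mul_one, Complex.norm_real, Complex.norm_real,
      Real.norm_of_nonneg hε.le, Real.norm_of_nonneg (hε.le.trans hεδ)]
  linarith

theorem norm_integral_inv_le {lam ε δ : ℝ} (hε : 0 < ε) (hεδ : ε ≤ δ) :
    ‖∫ r in ε..δ, ((r⁻¹ : ℝ) : ℂ) * Complex.exp ((-(lam / r) : ℝ) * Complex.I)‖ ≤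
      Real.log (δ / ε) := by
  rw [← integral_inv_of_pos hε (hε.trans_le hεδ)]
  apply intervalIntegral.norm_integral_le_of_norm_le hεδ
  · filter_upwards with r hr
    rw [norm_mul, Complex.norm_exp_ofReal_mul_I, mul_one, Complex.norm_real,
      Real.norm_of_nonneg (inv_nonneg.2 (hε.le.trans hr.1.le))]
  · apply intervalIntegral.intervalIntegrable_inv
    · intro r hr
      rw [Set.uIcc_of_le hεδ] at hr
      exact (hε.trans_le hr.1).ne'
    · exact continuousOn_id

/-- Split at `r = |λ|`: oscillation bounds the part below by `2`, and the trivial bound on the part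
above gives the logarithm. The bound does not depend on `ε`. -/
theorem norm_integral_osc_le_log {lam ε : ℝ} (hl : lam ≠ 0) (hl1 : |lam| ≤ 1) (hε : 0 < ε)
    (hε1 : ε ≤ 1) :
    ‖∫ r in ε..1, ((r⁻¹ : ℝ) : ℂ) * Complex.exp ((-(lam / r) : ℝ) * Complex.I)‖ ≤
      2 + Real.log (1 / |lam|) := by
  have hp : 0 < |lam| := abs_pos.2 hl
  rcases le_total |lam| ε with h | h
  · refine (norm_integral_inv_le hε hε1).trans ?_
    have : Real.log (1 / ε) ≤ Real.log (1 / |lam|) := by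
      apply Real.log_le_log (by positivity)
      gcongr
    linarith
  · have hint : ∀ a b : ℝ, 0 < a → 0 < b → IntervalIntegrable (fun r : ℝ => ((r⁻¹ : ℝ) : ℂ) *
        Complex.exp ((-(lam / r) : ℝ) * Complex.I)) volume a b := by
      intro a b ha hb
      apply ContinuousOn.intervalIntegrable
      have hne : ∀ r ∈ Set.uIcc a b, r ≠ 0 := fun r hr =>
        ((lt_min ha hb).trans_le hr.1).ne'
      have h1 : ContinuousOn (fun r : ℝ => -(lam / r)) (Set.uIcc a b) :=
        (continuousOn_const.div continuousOn_id hne).neg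
      exact (Complex.continuous_ofReal.comp_continuousOn (continuousOn_inv₀.mono hne)).mul
        (Complex.continuous_exp.comp_continuousOn
        ((Complex.continuous_ofReal.comp_continuousOn h1).mul continuousOn_const))
    rw [← intervalIntegral.integral_add_adjacent_intervals (hint ε |lam| hε hp) (hint |lam| 1 hp one_pos)]
    refine (norm_add_le _ _).trans (add_le_add ?_ (norm_integral_inv_le hp hl1))
    refine (norm_integral_osc_le hl hε h).trans_eq ?_
    field_simp

theorem enorm_integral_space_kernel_le {ε : ℝ} (hε : 0 < ε) (hε1 : ε ≤ 1) (σ : ℝ) :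
    ‖∫ r in Set.Ioc ε 1, (((4 * π * r)⁻¹ : ℝ) : ℂ) *
      Complex.exp ((-2 * (1 / (4 * r)) * σ : ℝ) * Complex.I)‖ₑ ≤ kern ‖σ‖ₑ := by
  have e : ∀ r : ℝ, (((4 * π * r)⁻¹ : ℝ) : ℂ) *
      Complex.exp ((-2 * (1 / (4 * r)) * σ : ℝ) * Complex.I) = (((4 * π)⁻¹ : ℝ) : ℂ) *
      (((r⁻¹ : ℝ) : ℂ) * Complex.exp ((-(σ / 2 / r) : ℝ) * Complex.I)) := by
    intro r
    rw [show (-2 * (1 / (4 * r)) * σ : ℝ) = -(σ / 2 / r) by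
      rcases eq_or_ne r 0 with h | h
      · simp [h]
      · field_simp; norm_num]
    push_cast
    rw [mul_inv (4 * (π : ℂ))]
    ring
  simp_rw [e]
  rw [integral_const_mul, ← intervalIntegral.integral_of_le hε1]
  set Z := ∫ r in ε..1, ((r⁻¹ : ℝ) : ℂ) * Complex.exp ((-(σ / 2 / r) : ℝ) * Complex.I) with hZ
  have main : σ ≠ 0 → ∀ q : ℝ, 1 / 4 ≤ q → q ≤ 3 / 4 → ‖Z‖ ≤ 6 * |σ / 2| ^ (-q) := by
    intro h0 q hq1 hq2
    have hl : σ / 2 ≠ 0 := by simpa using h0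
    have hp : 0 < |σ / 2| := abs_pos.2 hl
    rcases le_total |σ / 2| 1 with h | h
    · have h1 := norm_integral_osc_le_log hl h hε hε1
      -- The logarithm is at most `4 |σ/2|^{-1/4}`; with the additive `2` this makes the constant
      -- `6`.
      have h2 : Real.log (1 / |σ / 2|) ≤ (1 / |σ / 2|) ^ (1 / 4 : ℝ) / (1 / 4) :=
        Real.log_le_rpow_div (by positivity) (by norm_num)
      have h3 : (1 / |σ / 2|) ^ (1 / 4 : ℝ) = |σ / 2| ^ (-(1 / 4) : ℝ) := by
        rw [one_div, Real.inv_rpow hp.le, Real.rpow_neg hp.le]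
      have h4 : |σ / 2| ^ (-(1 / 4) : ℝ) ≤ |σ / 2| ^ (-q) :=
        Real.rpow_le_rpow_of_exponent_ge hp h (by linarith)
      have h5 : 1 ≤ |σ / 2| ^ (-q) := Real.one_le_rpow_of_pos_of_le_one_of_nonpos hp h (by linarith)
      rw [h3] at h2
      linarith
    · have h1 := norm_integral_osc_le hl hε hε1
      have h2 : |σ / 2|⁻¹ ≤ |σ / 2| ^ (-q) := by
        rw [← Real.rpow_neg_one]
        exact Real.rpow_le_rpow_of_exponent_le h (by linarith)
      rw [mul_one, div_eq_mul_inv (2 : ℝ) |σ / 2|] at h1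
      have : 0 < |σ / 2|⁻¹ := by positivity
      linarith
  have key := enorm_le_kern (z := (((4 * π)⁻¹ : ℝ) : ℂ) * Z) (C := 1) (σ := σ) one_pos ?_
  · simpa using key
  intro h0
  have hp : 0 < |σ| := abs_pos.2 h0
  have fin : ∀ q : ℝ, 1 / 4 ≤ q → q ≤ 3 / 4 → ‖(((4 * π)⁻¹ : ℝ) : ℂ) * Z‖ ≤ 1 * |σ| ^ (-q) := by
    intro q hq1 hq2
    have h1 := main h0 q hq1 hq2
    have h2 : |σ / 2| ^ (-q) ≤ 2 * |σ| ^ (-q) := by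
      rw [abs_div, abs_of_pos (two_pos : (0:ℝ) < 2), Real.div_rpow hp.le (by norm_num),
        Real.rpow_neg (by norm_num : (0:ℝ) ≤ 2), div_inv_eq_mul, mul_comm]
      gcongr
      calc (2:ℝ) ^ q ≤ 2 ^ (1:ℝ) := Real.rpow_le_rpow_of_exponent_le (by norm_num) (by linarith)
        _ = 2 := Real.rpow_one 2
    rw [norm_mul, Complex.norm_real, Real.norm_of_nonneg (by positivity), one_mul,
      inv_mul_le_iff₀ (by positivity)]
    have h3 : 0 < |σ| ^ (-q) := Real.rpow_pos_of_pos hp _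
    -- The constants fit because `6 · 2 ≤ 4π`.
    nlinarith [Real.pi_gt_three]
  exact ⟨fin _ le_rfl (by norm_num), fin _ (by norm_num) le_rfl⟩

/-- The master estimate on the physical side. -/
theorem enorm_Q4_le_physical (f₁ f₂ f₃ f₄ : L2) :
    ‖Q4 f₁ f₂ f₃ f₄‖ₑ ≤ 1 * absForm (fun x => ‖f₁ x‖ₑ) (fun x => ‖f₂ x‖ₑ)
      (fun x => ‖f₃ x‖ₑ) (fun x => ‖f₄ x‖ₑ) := by
  refine enorm_Q4_le_of_trunc (V := id) (U := id) continuous_id (fun _ => rfl) ?_ f₁ f₂ f₃ f₄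
  intro n f₁ f₂ f₃ f₄
  have hn : ∀ f : L2, Nice (trunc n f) := fun f => nice_trunc n (Lp.stronglyMeasurable f).measurable
  obtain ⟨hint, -⟩ := integrable_slice_and_eq (truncL2 n f₁) (truncL2 n f₂) (truncL2 n f₃)
    (truncL2 n f₄)
  -- The density `1/r` is not integrable at `0`, so Fubini is used on `(1/(k+1), 1]`, with a bound
  -- independent of `k`, and then `k → ∞`.
  have hmono : Monotone fun k : ℕ => Set.Ioc (1 / ((k : ℝ) + 1)) (1:ℝ) := by
    intro i j hij
    apply Set.Ioc_subset_Ioc_left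
    exact Nat.one_div_le_one_div hij
  have hunion : ⋃ k : ℕ, Set.Ioc (1 / ((k : ℝ) + 1)) (1:ℝ) = Set.Ioc 0 1 := by
    ext r
    simp only [Set.mem_iUnion, Set.mem_Ioc]
    constructor
    · rintro ⟨k, h1, h2⟩
      exact ⟨lt_trans (by positivity) h1, h2⟩
    · rintro ⟨h1, h2⟩
      obtain ⟨k, hk⟩ := exists_nat_one_div_lt h1
      exact ⟨k, hk, h2⟩
  have hlim := (tendsto_setIntegral_of_monotone (fun k => measurableSet_Ioc) hmono
    (by rw [hunion]; exact hint)).enorm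
  rw [hunion] at hlim
  rw [one_mul, Q4, intervalIntegral.integral_of_le zero_le_one]
  refine le_of_tendsto' hlim fun k => ?_
  have hk0 : (0:ℝ) < 1 / ((k : ℝ) + 1) := by positivity
  have hk1 : 1 / ((k : ℝ) + 1) ≤ 1 := by
    rw [div_le_one (by positivity)]; linarith [(Nat.cast_nonneg k : (0:ℝ) ≤ k)]
  have hw : IntegrableOn (fun r : ℝ => (((4 * π * r)⁻¹ : ℝ) : ℂ)) (Set.Ioc (1 / ((k : ℝ) + 1)) 1) := by
    refine IntegrableOn.mono_set ?_ Set.Ioc_subset_Icc_self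
    apply ContinuousOn.integrableOn_Icc
    refine Complex.continuous_ofReal.comp_continuousOn (ContinuousOn.inv₀ (by fun_prop) ?_)
    intro r hr
    have : 0 < r := hk0.trans_le hr.1
    positivity
  have key := enorm_setIntegral_resonant_le (hn f₁) (hn f₂) (hn f₃) (hn f₄)
    (t := fun r => 1 / (4 * r)) (K := fun σ => kern ‖σ‖ₑ) hw (by fun_prop)
    (enorm_integral_space_kernel_le hk0 hk1)
  simp only [enorm_resonant] at key
  refine le_trans (le_of_eq ?_) key
  congr 1
  apply setIntegral_congr_fun measurableSet_Ioc
  intro r hr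
  exact integral_T_four_eq (hn f₁) (hn f₂) (hn f₃) (hn f₄) (hk0.trans hr.1)

/-! ### Tails and their self-consistency inequality -/

theorem integrable_norm_sq_L2 (h : L2) : Integrable fun x => ‖h x‖ ^ 2 :=
  (Lp.memLp h).integrable_norm_pow (by norm_num)

theorem measurableSet_tail (s : ℝ) : MeasurableSet {x : ℝ | s ≤ |x|} :=
  measurableSet_le measurable_const measurable_id.abs

theorem l2Tail_nonneg (h : ℝ → ℂ) (s : ℝ) : 0 ≤ l2Tail h s := Real.sqrt_nonneg _

theorem l2Tail_antitone (h : L2) : Antitone (l2Tail h) := by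
  intro s t hst
  apply Real.sqrt_le_sqrt
  apply setIntegral_mono_set (integrable_norm_sq_L2 h).integrableOn
    (Eventually.of_forall fun x => by positivity)
  exact Eventually.of_forall fun x (hx : t ≤ |x|) => hst.trans hx

theorem l2Tail_tendsto (h : L2) : Tendsto (fun n : ℕ => l2Tail h n) atTop (𝓝 0) := by
  have h1 := tendsto_setIntegral_of_antitone (μ := volume) (f := fun x => ‖h x‖ ^ 2)
    (s := fun n : ℕ => {x : ℝ | (n : ℝ) ≤ |x|}) (fun n => measurableSet_tail n)
    (fun i j hij x (hx : (j : ℝ) ≤ |x|) => le_trans (by exact_mod_cast hij) hx)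
    ⟨0, (integrable_norm_sq_L2 h).integrableOn⟩
  have h2 : ⋂ n : ℕ, {x : ℝ | (n : ℝ) ≤ |x|} = ∅ := by
    ext x
    simp only [Set.mem_iInter, Set.mem_ofPred_eq, Set.mem_empty_iff_false, iff_false, not_forall,
      not_le]
    exact exists_nat_gt |x|
  rw [h2, setIntegral_empty] at h1
  have := (Real.continuous_sqrt.tendsto 0).comp h1
  rwa [Real.sqrt_zero] at this

/-- The part of `h` in the tail region. -/
def tailPart (h : L2) (s : ℝ) : L2 :=
  ((Lp.memLp h).indicator (measurableSet_tail s)).toLp ({x : ℝ | s ≤ |x|}.indicator h)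

theorem inner_tailPart (h : L2) (s : ℝ) : inner ℂ (tailPart h s) h = ((l2Tail h s ^ 2 : ℝ) : ℂ) := by
  have e : ∫ x, inner ℂ (tailPart h s x) (h x) =
      ∫ x, (({x : ℝ | s ≤ |x|}.indicator (fun x => ‖h x‖ ^ 2) x : ℝ) : ℂ) := by
    apply integral_congr_ae
    filter_upwards [((Lp.memLp h).indicator (measurableSet_tail s)).coeFn_toLp] with x hx
    rw [tailPart, hx, RCLike.inner_apply, Set.indicator_apply, Set.indicator_apply]
    split_ifs
    · rw [mul_comm, ← Complex.normSq_eq_conj_mul_self, Complex.normSq_eq_norm_sq]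
    · simp
  rw [L2.inner_def, e, integral_complex_ofReal, integral_indicator (measurableSet_tail s), l2Tail,
    Real.sq_sqrt (integral_nonneg fun x => by positivity)]

/-- The modulus of `h` cut to the tail region. -/
def cut (h : L2) (s x : ℝ) : ℝ≥0∞ := {x : ℝ | s ≤ |x|}.indicator (fun x => ‖h x‖ₑ) x

theorem measurable_enorm_L2 (h : L2) : Measurable fun x => ‖h x‖ₑ :=
  (Lp.stronglyMeasurable h).measurable.enorm

theorem measurable_cut (h : L2) (s : ℝ) : Measurable (cut h s) :=
  (measurable_enorm_L2 h).indicator (measurableSet_tail s)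

theorem enorm_tailPart (h : L2) (s : ℝ) : (fun x => ‖tailPart h s x‖ₑ) =ᵐ[volume] cut h s := by
  filter_upwards [((Lp.memLp h).indicator (measurableSet_tail s)).coeFn_toLp] with x hx
  rw [tailPart, hx, cut, Set.indicator_apply, Set.indicator_apply]
  split_ifs <;> simp

theorem size_cut (h : L2) (s : ℝ) : size (cut h s) = ENNReal.ofReal (l2Tail h s) := by
  have e : ∀ x, cut h s x ^ (2 : ℝ) = {x : ℝ | s ≤ |x|}.indicator
      (fun x => ENNReal.ofReal (‖h x‖ ^ 2)) x := by
    intro x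
    rw [cut, Set.indicator_apply, Set.indicator_apply]
    split_ifs
    · rw [ENNReal.ofReal_pow (norm_nonneg _), ofReal_norm, ← ENNReal.rpow_natCast]
      norm_num
    · simp
  rw [size]
  simp_rw [e]
  rw [lintegral_indicator (measurableSet_tail s), ← ofReal_integral_eq_lintegral_ofReal
    (integrable_norm_sq_L2 h).integrableOn (Eventually.of_forall fun x => by positivity), l2Tail,
    Real.sqrt_eq_rpow, ENNReal.ofReal_rpow_of_nonneg _ (by norm_num)]
  exact integral_nonneg fun x => by positivity

theorem size_L2 (h : L2) : size (fun x => ‖h x‖ₑ) = ENNReal.ofReal ‖h‖ := by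
  rw [size_enorm, Lp.norm_def, ENNReal.ofReal_toReal (Lp.eLpNorm_ne_top h)]

/-- Let `|y| ≥ 3s`. If `|a|, |b| < s`, the other three points keep modulus at least `s`. Otherwise
some separation is at least `s`, and at least one other point still has modulus at least `s`. -/
theorem resProd_cut_le (h : L2) {s : ℝ} (hs : 0 < s) (p : ℝ × ℝ × ℝ) :
    resProd (cut h (3 * s)) (fun x => ‖h x‖ₑ) (fun x => ‖h x‖ₑ) (fun x => ‖h x‖ₑ) p ≤
      resProd (cut h (3 * s)) (cut h s) (cut h s) (cut h s) p +
      ({p : ℝ × ℝ × ℝ | s ≤ max |p.1| |p.2.2|}.indicator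
        (resProd (cut h (3 * s)) (cut h s) (fun x => ‖h x‖ₑ) (fun x => ‖h x‖ₑ)) p +
      {p : ℝ × ℝ × ℝ | s ≤ max |p.1| |p.2.2|}.indicator
        (resProd (cut h (3 * s)) (fun x => ‖h x‖ₑ) (cut h s) (fun x => ‖h x‖ₑ)) p +
      {p : ℝ × ℝ × ℝ | s ≤ max |p.1| |p.2.2|}.indicator
        (resProd (cut h (3 * s)) (fun x => ‖h x‖ₑ) (fun x => ‖h x‖ₑ) (cut h s)) p) := by
  obtain ⟨a, y, b⟩ := p
  by_cases hy : 3 * s ≤ |y|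
  swap
  · have : cut h (3 * s) y = 0 :=
      Set.indicator_of_notMem (s := {x : ℝ | 3 * s ≤ |x|}) hy _
    simp [resProd, this]
  have hcut : ∀ z, s ≤ |z| → cut h s z = ‖h z‖ₑ := fun z hz =>
    Set.indicator_of_mem (s := {x : ℝ | s ≤ |x|}) hz _
  by_cases hsep : s ≤ max |a| |b|
  · have hin : ((a, y, b) : ℝ × ℝ × ℝ) ∈ {p : ℝ × ℝ × ℝ | s ≤ max |p.1| |p.2.2|} := hsep
    rw [Set.indicator_of_mem hin, Set.indicator_of_mem hin, Set.indicator_of_mem hin]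
    by_cases h2 : s ≤ |y + a|
    · refine le_trans ?_ (self_le_add_left _ _)
      refine le_trans ?_ (self_le_add_right _ _)
      refine le_trans ?_ (self_le_add_right _ _)
      simp only [resProd]
      rw [hcut _ h2]
    by_cases h3 : s ≤ |y + a + b|
    · refine le_trans ?_ (self_le_add_left _ _)
      refine le_trans ?_ (self_le_add_right _ _)
      refine le_trans ?_ (self_le_add_left _ _)
      simp only [resProd]
      rw [hcut _ h3]
    by_cases h4 : s ≤ |y + b|
    · refine le_trans ?_ (self_le_add_left _ _)
      refine le_trans ?_ (self_le_add_left _ _)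
      simp only [resProd]
      rw [hcut _ h4]
    -- Since `y = (y+a) - (y+a+b) + (y+b)`, three moduli below `s` would give `|y| < 3s`.
    exfalso
    push Not at h2 h3 h4
    rw [abs_lt] at h2 h3 h4
    rcases le_abs'.1 hy with h' | h' <;> linarith
  · push Not at hsep
    obtain ⟨ha, hb⟩ := max_lt_iff.1 hsep
    rw [abs_lt] at ha hb
    have h2 : s ≤ |y + a| := by
      rw [le_abs']
      rcases le_abs'.1 hy with h' | h'
      · left; linarith
      · right; linarith
    have h3 : s ≤ |y + a + b| := by
      rw [le_abs']
      rcases le_abs'.1 hy with h' | h'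
      · left; linarith
      · right; linarith
    have h4 : s ≤ |y + b| := by
      rw [le_abs']
      rcases le_abs'.1 hy with h' | h'
      · left; linarith
      · right; linarith
    refine le_trans ?_ (self_le_add_right _ _)
    simp only [resProd]
    rw [hcut _ h2, hcut _ h3, hcut _ h4]

/-- The unseparated part carries three tails at `s`. Each of the three separated parts carries one
such tail, two full norms and the gain `s^{-1/2}`; hence the factor `3`. -/
theorem absForm_cut_le (h : L2) {s : ℝ} (hs : 0 < s) :
    absForm (cut h (3 * s)) (fun x => ‖h x‖ₑ) (fun x => ‖h x‖ₑ) (fun x => ‖h x‖ₑ) ≤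
      formConst * (size (cut h (3 * s)) * size (cut h s) *
        (size (cut h s) ^ 2 + 3 * (ENNReal.ofReal s ^ (1 / 2 : ℝ))⁻¹ *
          size (fun x => ‖h x‖ₑ) ^ 2)) := by
  set u : ℝ → ℝ≥0∞ := fun x => ‖h x‖ₑ with hu
  have mu : Measurable u := measurable_enorm_L2 h
  have mv := measurable_cut h s
  have mw := measurable_cut h (3 * s)
  set E : Set (ℝ × ℝ × ℝ) := {p | s ≤ max |p.1| |p.2.2|} with hE
  have mE : MeasurableSet E := measurableSet_le measurable_const (by fun_prop)
  have mk : Measurable fun p : ℝ × ℝ × ℝ => kern ‖p.1 * p.2.2‖ₑ :=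
    measurable_kern.comp (by fun_prop)
  have hmeas : ∀ {u₁ u₂ u₃ u₄ : ℝ → ℝ≥0∞}, Measurable u₁ → Measurable u₂ → Measurable u₃ →
      Measurable u₄ → Measurable fun p : ℝ × ℝ × ℝ => kern ‖p.1 * p.2.2‖ₑ * resProd u₁ u₂ u₃ u₄ p :=
    fun m₁ m₂ m₃ m₄ => mk.mul (measurable_resProd m₁ m₂ m₃ m₄)
  have hind : ∀ (u₁ u₂ u₃ u₄ : ℝ → ℝ≥0∞) (p : ℝ × ℝ × ℝ),
      kern ‖p.1 * p.2.2‖ₑ * E.indicator (resProd u₁ u₂ u₃ u₄) p =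
      E.indicator (fun p => kern ‖p.1 * p.2.2‖ₑ * resProd u₁ u₂ u₃ u₄ p) p := by
    intro u₁ u₂ u₃ u₄ p
    rw [Set.indicator_apply, Set.indicator_apply]
    split_ifs <;> simp
  calc absForm (cut h (3 * s)) u u u
      ≤ ∫⁻ p : ℝ × ℝ × ℝ, (kern ‖p.1 * p.2.2‖ₑ * resProd (cut h (3 * s)) (cut h s) (cut h s) (cut h s) p +
        (E.indicator (fun p => kern ‖p.1 * p.2.2‖ₑ * resProd (cut h (3 * s)) (cut h s) u u p) p +
         E.indicator (fun p => kern ‖p.1 * p.2.2‖ₑ * resProd (cut h (3 * s)) u (cut h s) u p) p +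
         E.indicator (fun p => kern ‖p.1 * p.2.2‖ₑ * resProd (cut h (3 * s)) u u (cut h s) p) p)) := by
        apply lintegral_mono
        intro p
        simp only [← hind, ← mul_add]
        gcongr
        exact resProd_cut_le h hs p
    _ ≤ formConst * (size (cut h (3 * s)) * size (cut h s) * size (cut h s) * size (cut h s)) +
        ((ENNReal.ofReal s ^ (1 / 2 : ℝ))⁻¹ * formConst * (size (cut h (3 * s)) * size (cut h s) * size u * size u) +
         (ENNReal.ofReal s ^ (1 / 2 : ℝ))⁻¹ * formConst * (size (cut h (3 * s)) * size u * size (cut h s) * size u) +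
         (ENNReal.ofReal s ^ (1 / 2 : ℝ))⁻¹ * formConst * (size (cut h (3 * s)) * size u * size u * size (cut h s))) := by
        rw [lintegral_add_left (hmeas mw mv mv mv), lintegral_add_right _ ((hmeas mw mu mu mv).indicator mE),
          lintegral_add_right _ ((hmeas mw mu mv mu).indicator mE)]
        gcongr
        · exact absForm_le mw mv mv mv
        · exact lintegral_separated_le mw mv mu mu hs
        · exact lintegral_separated_le mw mu mv mu hs
        · exact lintegral_separated_le mw mu mu mv hs
    _ = _ := by ring

/-- Needed because `tailPart` agrees with `cut` only almost everywhere; null sets pull back to null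
sets under the projection to `y`. -/
theorem absForm_congr {u u' u₂ u₃ u₄ : ℝ → ℝ≥0∞} (h : u =ᵐ[volume] u') :
    absForm u u₂ u₃ u₄ = absForm u' u₂ u₃ u₄ := by
  have key : (fun p : ℝ × ℝ × ℝ => u p.2.1) =ᵐ[volume] fun p => u' p.2.1 := by
    have h1 : (fun q : ℝ × ℝ => u q.1) =ᵐ[volume] fun q => u' q.1 :=
      (Measure.quasiMeasurePreserving_fst (μ := (volume : Measure ℝ)) (ν := (volume : Measure ℝ))).ae_eq_comp h
    exact (Measure.quasiMeasurePreserving_snd (μ := (volume : Measure ℝ))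
      (ν := (volume : Measure (ℝ × ℝ)))).ae_eq_comp h1
  apply lintegral_congr_ae
  filter_upwards [key] with p hp
  simp only [resProd, hp]

/-- The self-consistency inequality for the tails. -/
theorem l2Tail_three_mul_le {ω : ℝ} (hω : ω ≠ 0) {h : L2}
    (hh : ∀ g : L2, ‖(ω : ℂ) * inner ℂ g h‖ₑ ≤ absForm (fun x => ‖g x‖ₑ) (fun x => ‖h x‖ₑ)
      (fun x => ‖h x‖ₑ) (fun x => ‖h x‖ₑ)) :
    ∃ C : ℝ, 0 ≤ C ∧ ∀ s : ℝ, 0 < s →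
      l2Tail h (3 * s) ≤ C * l2Tail h s * (l2Tail h s ^ 2 + s ^ (-(1 / 2) : ℝ)) := by
  set K := formConst.toReal with hK
  have hK0 : 0 ≤ K := ENNReal.toReal_nonneg
  have hKe : formConst = ENNReal.ofReal K := (ENNReal.ofReal_toReal formConst_lt_top.ne).symm
  have hω0 : 0 < |ω| := abs_pos.2 hω
  -- The factor `1 + 3‖h‖²` allows `t² + 3 s^{-1/2} ‖h‖²` to be replaced by a multiple of `t² +
  -- s^{-1/2}`.
  refine ⟨K / |ω| * (1 + 3 * ‖h‖ ^ 2), by positivity, fun s hs => ?_⟩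
  set t3 := l2Tail h (3 * s) with ht3
  set t := l2Tail h s with ht
  have h3 : 0 ≤ t3 := l2Tail_nonneg _ _
  have h0 : 0 ≤ t := l2Tail_nonneg _ _
  have hsp : 0 < s ^ (-(1 / 2) : ℝ) := Real.rpow_pos_of_pos hs _
  have h1 := hh (tailPart h (3 * s))
  rw [inner_tailPart, absForm_congr (enorm_tailPart h (3 * s))] at h1
  have h2 := h1.trans (absForm_cut_le h hs)
  rw [size_cut, size_cut, size_L2, hKe, ← ofReal_norm, ← ht3, ← ht] at h2
  have hse : (ENNReal.ofReal s ^ (1 / 2 : ℝ))⁻¹ = ENNReal.ofReal (s ^ (-(1 / 2) : ℝ)) := by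
    rw [ENNReal.ofReal_rpow_of_pos hs, ← ENNReal.ofReal_inv_of_pos (by positivity),
      Real.rpow_neg hs.le]
  rw [hse, show (3 : ℝ≥0∞) = ENNReal.ofReal 3 by norm_num, ← ENNReal.ofReal_pow h0,
    ← ENNReal.ofReal_pow (norm_nonneg h), ← ENNReal.ofReal_mul (by norm_num : (0:ℝ) ≤ 3),
    ← ENNReal.ofReal_mul (by positivity : (0:ℝ) ≤ 3 * s ^ (-(1 / 2) : ℝ)),
    ← ENNReal.ofReal_add (sq_nonneg t) (by positivity),
    ← ENNReal.ofReal_mul h3, ← ENNReal.ofReal_mul (mul_nonneg h3 h0), ← ENNReal.ofReal_mul hK0,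
    ENNReal.ofReal_le_ofReal_iff (by positivity), norm_mul, Complex.norm_real, Complex.norm_real,
    Real.norm_eq_abs, Real.norm_of_nonneg (sq_nonneg _)] at h2
  -- The tested equation is quadratic in the tail at `3s`; one factor is divided out unless it
  -- vanishes.
  rcases h3.eq_or_lt with h5 | h5
  · rw [← h5]; positivity
  have h6 : |ω| * t3 ≤ K * (t * (t ^ 2 + 3 * s ^ (-(1 / 2) : ℝ) * ‖h‖ ^ 2)) := by
    have : t3 * (|ω| * t3) ≤ t3 * (K * (t * (t ^ 2 + 3 * s ^ (-(1 / 2) : ℝ) * ‖h‖ ^ 2))) := by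
      calc _ = |ω| * t3 ^ 2 := by ring
        _ ≤ _ := h2
        _ = _ := by ring
    exact le_of_mul_le_mul_left this h5
  have h7 : K * (t * (t ^ 2 + 3 * s ^ (-(1 / 2) : ℝ) * ‖h‖ ^ 2)) ≤
      K * (t * ((1 + 3 * ‖h‖ ^ 2) * (t ^ 2 + s ^ (-(1 / 2) : ℝ)))) := by
    gcongr
    nlinarith [mul_nonneg (sq_nonneg ‖h‖) (sq_nonneg t)]
  calc t3 = |ω| * t3 / |ω| := by field_simp
    _ ≤ K * (t * ((1 + 3 * ‖h‖ ^ 2) * (t ^ 2 + s ^ (-(1 / 2) : ℝ)))) / |ω| := by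
        exact div_le_div_of_nonneg_right (h6.trans h7) hω0.le
    _ = _ := by ring

/-! ### Iterating the recursion -/

/-- The conclusion about a tail function. -/
theorem tail_decay_of_recursion {t : ℝ → ℝ} (hanti : Antitone t) (hnn : ∀ s, 0 ≤ t s)
    (hlim : Tendsto (fun n : ℕ => t n) atTop (𝓝 0)) {C : ℝ} (hC : 0 ≤ C)
    (hrec : ∀ s, 0 < s → t (3 * s) ≤ C * t s * (t s ^ 2 + s ^ (-(1 / 2) : ℝ))) :
    ∃ s₀ : ℝ, 0 < s₀ ∧ ∀ s : ℝ, s₀ ≤ s → t s ≤ t s₀ * (3 : ℝ) ^ (1 / 4 : ℝ) *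
          (3 : ℝ) ^ (-((Real.logb 3 (s / (3 * s₀))) ^ 2 / 4)) := by
  have h3 : (0:ℝ) < 3 := by norm_num
  have hsmall : Tendsto (fun n : ℕ => C * ((3:ℝ) ^ (1 / 2 : ℝ) * t n ^ 2 + (n : ℝ) ^ (-(1 / 2) : ℝ)))
      atTop (𝓝 (C * ((3:ℝ) ^ (1 / 2 : ℝ) * 0 ^ 2 + 0))) :=
    (((hlim.pow 2).const_mul _).add ((tendsto_rpow_neg_atTop (by norm_num)).comp
      tendsto_natCast_atTop_atTop)).const_mul C
  -- Smallness of this quantity is the only condition on `s₀`: the `3^{1/2}` is the square of the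
  -- factor `3^{1/4}` in the induction bound, and `3^{-1/4}` is what completes the square below.
  have hev : ∀ᶠ n : ℕ in atTop, C * ((3:ℝ) ^ (1 / 2 : ℝ) * t n ^ 2 + (n : ℝ) ^ (-(1 / 2) : ℝ)) ≤
      (3:ℝ) ^ (-(1 / 4) : ℝ) := by
    refine (hsmall.eventually_lt_const ?_).mono fun n hn => hn.le
    simp only [ne_eq, OfNat.ofNat_ne_zero, not_false_eq_true, zero_pow, mul_zero, add_zero]
    positivity
  obtain ⟨N, hN, hN1⟩ := (hev.and (eventually_ge_atTop 1)).exists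
  set s₀ : ℝ := (N : ℝ) with hs₀
  have hs0 : 0 < s₀ := by rw [hs₀]; exact_mod_cast hN1
  have ind : ∀ n : ℕ, t ((3:ℝ) ^ n * s₀) ≤
      t s₀ * (3:ℝ) ^ (1 / 4 : ℝ) * (3:ℝ) ^ (-((n:ℝ) ^ 2 / 4)) := by
    intro n
    induction n with
    | zero =>
      simp only [pow_zero, one_mul, Nat.cast_zero]
      rw [show (-((0:ℝ) ^ 2 / 4)) = 0 by norm_num, Real.rpow_zero, mul_one]
      exact le_mul_of_one_le_right (hnn _) (Real.one_le_rpow (by norm_num) (by norm_num))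
    | succ n ih =>
      set tn := t ((3:ℝ) ^ n * s₀) with htn
      have hpos : 0 < (3:ℝ) ^ n * s₀ := by positivity
      have h1 := hrec _ hpos
      rw [← htn, ← mul_assoc, ← pow_succ'] at h1
      have e1 : ((3:ℝ) ^ n * s₀) ^ (-(1 / 2) : ℝ) = (3:ℝ) ^ (-((n:ℝ) / 2)) * s₀ ^ (-(1 / 2) : ℝ) := by
        rw [Real.mul_rpow (by positivity) hs0.le, ← Real.rpow_natCast, ← Real.rpow_mul h3.le]
        congr 2; ring
      have e2 : tn ^ 2 ≤ (3:ℝ) ^ (-((n:ℝ) / 2)) * ((3:ℝ) ^ (1 / 2 : ℝ) * t s₀ ^ 2) := by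
        calc tn ^ 2 ≤ (t s₀ * (3:ℝ) ^ (1 / 4 : ℝ) * (3:ℝ) ^ (-((n:ℝ) ^ 2 / 4))) ^ 2 :=
              pow_le_pow_left₀ (hnn _) ih 2
          _ = t s₀ ^ 2 * (3:ℝ) ^ (1 / 2 : ℝ) * (3:ℝ) ^ (-((n:ℝ) ^ 2 / 2)) := by
              rw [mul_pow, mul_pow, ← Real.rpow_natCast ((3:ℝ) ^ (1 / 4 : ℝ)),
                ← Real.rpow_natCast ((3:ℝ) ^ (-((n:ℝ) ^ 2 / 4))), ← Real.rpow_mul h3.le,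
                ← Real.rpow_mul h3.le]
              congr 2
              · norm_num
              · push_cast; ring
          -- From `n ≤ n²`: the cubic term is reduced to the rate `3^{-n/2}` of `(3ⁿ s₀)^{-1/2}`.
          _ ≤ t s₀ ^ 2 * (3:ℝ) ^ (1 / 2 : ℝ) * (3:ℝ) ^ (-((n:ℝ) / 2)) := by
              gcongr
              · norm_num
              · have : (n:ℝ) ≤ (n:ℝ) ^ 2 := by exact_mod_cast Nat.le_self_pow (by norm_num) n
                exact this
          _ = _ := by ring
      have e3 : C * (tn ^ 2 + ((3:ℝ) ^ n * s₀) ^ (-(1 / 2) : ℝ)) ≤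
          (3:ℝ) ^ (-((n:ℝ) / 2)) * (3:ℝ) ^ (-(1 / 4) : ℝ) := by
        calc _ ≤ C * ((3:ℝ) ^ (-((n:ℝ) / 2)) * ((3:ℝ) ^ (1 / 2 : ℝ) * t s₀ ^ 2) +
                (3:ℝ) ^ (-((n:ℝ) / 2)) * s₀ ^ (-(1 / 2) : ℝ)) := by
              rw [e1]; gcongr
          _ = (3:ℝ) ^ (-((n:ℝ) / 2)) * (C * ((3:ℝ) ^ (1 / 2 : ℝ) * t s₀ ^ 2 +
                s₀ ^ (-(1 / 2) : ℝ))) := by ring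
          _ ≤ _ := by gcongr
      calc t ((3:ℝ) ^ (n + 1) * s₀) ≤ C * tn * (tn ^ 2 + ((3:ℝ) ^ n * s₀) ^ (-(1 / 2) : ℝ)) := h1
        _ = tn * (C * (tn ^ 2 + ((3:ℝ) ^ n * s₀) ^ (-(1 / 2) : ℝ))) := by ring
        _ ≤ (t s₀ * (3:ℝ) ^ (1 / 4 : ℝ) * (3:ℝ) ^ (-((n:ℝ) ^ 2 / 4))) *
            ((3:ℝ) ^ (-((n:ℝ) / 2)) * (3:ℝ) ^ (-(1 / 4) : ℝ)) := by
            have := hnn s₀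
            exact mul_le_mul ih e3 (mul_nonneg hC (by positivity)) (by positivity)
        _ = t s₀ * (3:ℝ) ^ (1 / 4 : ℝ) * ((3:ℝ) ^ (-((n:ℝ) ^ 2 / 4)) *
            ((3:ℝ) ^ (-((n:ℝ) / 2)) * (3:ℝ) ^ (-(1 / 4) : ℝ))) := by ring
        -- The exponents combine through `n²/4 + n/2 + 1/4 = (n+1)²/4`.
        _ = _ := by
            rw [← Real.rpow_add h3, ← Real.rpow_add h3]
            congr 2; push_cast; ring
  refine ⟨s₀, hs0, fun s hs => ?_⟩
  have hspos : 0 < s := hs0.trans_le hs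
  set x := Real.logb 3 (s / s₀) with hx
  have hx0 : 0 ≤ x := Real.logb_nonneg (by norm_num) ((one_le_div hs0).2 hs)
  have hlog : Real.logb 3 (s / (3 * s₀)) = x - 1 := by
    rw [show s / (3 * s₀) = s / s₀ / 3 by field_simp, Real.logb_div (by positivity) (by norm_num),
      Real.logb_self_eq_one (by norm_num)]
  rw [hlog]
  have hfl := Nat.floor_le hx0
  have hfl2 := Nat.lt_floor_add_one x
  set n := ⌊x⌋₊ with hn
  have hle : (3:ℝ) ^ n * s₀ ≤ s := by
    have h4 : (3:ℝ) ^ (n:ℝ) ≤ 3 ^ x := Real.rpow_le_rpow_of_exponent_le (by norm_num) hfl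
    rw [hx, Real.rpow_logb h3 (by norm_num) (by positivity), Real.rpow_natCast, le_div_iff₀ hs0] at h4
    exact h4
  have hts := hnn s₀
  rcases lt_or_ge x 1 with h1 | h1
  -- For `0 ≤ x < 1` one has `(x-1)²/4 ≤ 1/4`, and the factor `3^{1/4}` makes up for the loss.
  · have h5 : t s ≤ t s₀ := hanti hs
    refine h5.trans ?_
    rw [mul_assoc, ← Real.rpow_add h3]
    refine le_mul_of_one_le_right hts (Real.one_le_rpow (by norm_num) ?_)
    nlinarith
  -- Rounding `x` down to `n` loses at most `1`, so `n ≥ x - 1 ≥ 0`; this is the `3` in `s/(3s₀)`.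
  · refine (hanti hle).trans ((ind n).trans ?_)
    gcongr
    · norm_num
    · linarith

theorem poly_decay_of_tail {t : ℝ → ℝ} (hanti : Antitone t) (hnn : ∀ s, 0 ≤ t s) {s₀ : ℝ}
    (hs₀ : 0 < s₀) (h : ∀ s : ℝ, s₀ ≤ s → t s ≤ t s₀ * (3 : ℝ) ^ (1 / 4 : ℝ) *
          (3 : ℝ) ^ (-((Real.logb 3 (s / (3 * s₀))) ^ 2 / 4))) {γ : ℝ} (hγ : 0 < γ) :
    ∃ C : ℝ, ∀ s : ℝ, 0 < s → t s ≤ C * s ^ (-γ) := by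
  have h3 : (0:ℝ) < 3 := by norm_num
  set C₁ := t s₀ * (3 : ℝ) ^ (1 / 4 : ℝ) * 3 ^ (γ ^ 2) * (3 * s₀) ^ γ with hC₁
  set C₂ := t 0 * s₀ ^ γ with hC₂
  have h10 : 0 ≤ C₁ := by have := hnn s₀; positivity
  have h20 : 0 ≤ C₂ := by have := hnn 0; positivity
  refine ⟨C₁ + C₂, fun s hs => ?_⟩
  have hsγ : 0 < s ^ (-γ) := Real.rpow_pos_of_pos hs _
  rcases le_total s₀ s with hle | hle
  · refine le_trans ?_ (mul_le_mul_of_nonneg_right (le_add_of_nonneg_right h20) hsγ.le)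
    refine (h s hle).trans ?_
    set x := Real.logb 3 (s / (3 * s₀)) with hx
    have hsx : (3:ℝ) ^ x = s / (3 * s₀) := Real.rpow_logb h3 (by norm_num) (by positivity)
    have e : (3 * s₀) ^ γ * s ^ (-γ) = 3 ^ (-γ * x) := by
      rw [mul_comm (-γ) x, Real.rpow_mul h3.le, hsx, Real.div_rpow hs.le (by positivity),
        Real.rpow_neg (by positivity : (0:ℝ) ≤ 3 * s₀), div_inv_eq_mul, mul_comm]
    rw [hC₁, mul_assoc _ ((3 * s₀) ^ γ), e, mul_assoc _ ((3:ℝ) ^ (γ ^ 2)), ← Real.rpow_add h3]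
    have := hnn s₀
    gcongr
    · norm_num
    -- From `(x/2 - γ)² ≥ 0` one gets `-x²/4 ≤ γ² - γx`, which explains the factor `3^{γ²}` in `C₁`.
    · nlinarith [sq_nonneg (x / 2 - γ)]
  · refine le_trans ?_ (mul_le_mul_of_nonneg_right (le_add_of_nonneg_left h10) hsγ.le)
    refine (hanti hs.le).trans ?_
    rw [hC₂, mul_assoc]
    refine le_mul_of_one_le_right (hnn 0) ?_
    rw [Real.rpow_neg hs.le, ← div_eq_mul_inv, one_le_div (by positivity)]
    exact Real.rpow_le_rpow hs.le hle hγ.le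

/-! ### The case of zero `ω`, rescaled frequencies, and the conclusion -/

/-- A function with vanishing diagonal form vanishes. -/
theorem eq_zero_of_Q4_self_eq_zero {f : L2} (h : Q4 f f f f = 0) : f = 0 := by
  rw [Q4_eq_inner, inner_self_eq_zero] at h
  have h1 : ∀ᵐ p ∂spaceTime, lift f p = 0 := by
    have h2 := coeFn_mulL4 (lift f) (lift f)
    rw [h] at h2
    filter_upwards [h2, Lp.coeFn_zero ℂ 2 spaceTime] with p hp hp0
    rw [hp0] at hp
    exact mul_self_eq_zero.1 hp.symm
  have h3 : ∀ᵐ r ∂(volume.restrict (Set.Ioc (0:ℝ) 1)), T r f = 0 := by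
    filter_upwards [lift_slice f, Measure.ae_ae_of_ae_prod h1] with r k1 k2
    apply Lp.ext
    filter_upwards [k1, k2, Lp.coeFn_zero ℂ 2 (volume : Measure ℝ)] with x j1 j2 j3
    rw [← j1, j2, j3, Pi.zero_apply]
  -- The time interval has positive measure, so some single `r` has `T r f = 0`, and `T r` is an
  -- isometry.
  have : NeBot (ae (volume.restrict (Set.Ioc (0:ℝ) 1))) := by
    rw [ae_neBot, Ne, Measure.restrict_eq_zero]
    simp
  obtain ⟨r, hr⟩ := h3.exists
  rw [← norm_eq_zero, ← norm_T r f, hr, norm_zero]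

/-- The normalising factor `(2π)^{-1/2}` squares to the inverse of the Jacobian of `k = 2πξ`, so
only the cutoff is rescaled. -/
theorem tailβ_eq (f : L2) (s : ℝ) : tailβ f s = l2Tail (𝓕 f : L2) (s / (2 * π)) := by
  have hp : 0 < 2 * π := by positivity
  rw [tailβ, l2Tail, l2Tail]
  congr 1
  rw [← integral_indicator (measurableSet_tail _), ← integral_indicator (measurableSet_tail _)]
  set g : ℝ → ℝ := {x : ℝ | s / (2 * π) ≤ |x|}.indicator fun x => ‖(𝓕 f : L2) x‖ ^ 2 with hg
  have e : ∀ x, {x : ℝ | s ≤ |x|}.indicator (fun x => ‖unitaryFourier f x‖ ^ 2) x =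
      (2 * π)⁻¹ * g (x / (2 * π)) := by
    intro x
    have hiff : (s / (2 * π) ≤ |x / (2 * π)|) ↔ s ≤ |x| := by
      rw [abs_div, abs_of_pos hp, div_le_div_iff_of_pos_right hp]
    rw [hg, Set.indicator_apply, Set.indicator_apply]
    simp only [Set.mem_ofPred_eq, hiff]
    split_ifs
    · rw [unitaryFourier, norm_mul, mul_pow, Complex.norm_real, Real.norm_of_nonneg (by positivity),
        inv_pow, Real.sq_sqrt hp.le]
    · simp
  simp_rw [e]
  rw [integral_const_mul, Measure.integral_comp_div, abs_of_pos hp, smul_eq_mul, ← mul_assoc,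
    inv_mul_cancel₀ hp.ne', one_mul]

/-- For `ω = 0` testing with `f` itself gives `f = 0` and both tails vanish. For `ω ≠ 0` the two
quadrilinear bounds apply; on the Fourier side the test function is transported by unitarity. -/
theorem exists_tail_recursion {ω : ℝ} {f : L2} (hf : IsWeakSolution ω f) :
    (∃ C : ℝ, 0 ≤ C ∧ ∀ s : ℝ, 0 < s → l2Tail f (3 * s) ≤
      C * l2Tail f s * (l2Tail f s ^ 2 + s ^ (-(1 / 2) : ℝ))) ∧
    (∃ C : ℝ, 0 ≤ C ∧ ∀ s : ℝ, 0 < s → l2Tail (𝓕 f : L2) (3 * s) ≤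
      C * l2Tail (𝓕 f : L2) s * (l2Tail (𝓕 f : L2) s ^ 2 + s ^ (-(1 / 2) : ℝ))) := by
  rcases eq_or_ne ω 0 with h0 | h0
  · have hQ : Q4 f f f f = 0 := by rw [← hf f, h0]; simp
    have hf0 := eq_zero_of_Q4_self_eq_zero hQ
    have hz : ∀ h : L2, h = 0 → ∀ s, l2Tail h s = 0 := by
      intro h hh s
      rw [l2Tail, Real.sqrt_eq_zero']
      apply le_of_eq
      apply integral_eq_zero_of_ae
      have := Lp.coeFn_zero ℂ 2 (volume : Measure ℝ)
      rw [← hh] at this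
      filter_upwards [ae_restrict_of_ae this] with x hx
      rw [hx]; simp
    have hF0 : (𝓕 f : L2) = 0 := by
      rw [← norm_eq_zero, Lp.norm_fourier_eq, hf0, norm_zero]
    exact ⟨⟨0, le_rfl, fun s _ => by simp [hz f hf0]⟩,
      ⟨0, le_rfl, fun s _ => by simp [hz (𝓕 f) hF0]⟩⟩
  · constructor
    · refine l2Tail_three_mul_le h0 fun g => ?_
      rw [hf g]
      simpa using enorm_Q4_le_physical g f f f
    · refine l2Tail_three_mul_le h0 fun g => ?_
      have h1 : inner ℂ g (𝓕 f : L2) = inner ℂ (𝓕⁻ g : L2) f := by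
        rw [← Lp.inner_fourier_eq (𝓕⁻ g : L2) f, FourierTransform.fourier_fourierInv_eq]
      rw [h1, hf]
      have := enorm_Q4_le_fourier (𝓕⁻ g : L2) f f f
      rwa [FourierTransform.fourier_fourierInv_eq, one_mul] at this

theorem tailβ_antitone (f : L2) : Antitone (tailβ f) := by
  intro s t hst
  rw [tailβ_eq, tailβ_eq]
  apply l2Tail_antitone
  gcongr

theorem tailβ_tendsto (f : L2) : Tendsto (fun n : ℕ => tailβ f n) atTop (𝓝 0) := by
  have hsub : Tendsto (l2Tail (𝓕 f : L2)) atTop (𝓝 0) := by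
    refine tendsto_order.2 ⟨fun a ha => Eventually.of_forall fun x =>
      ha.trans_le (l2Tail_nonneg _ _), fun a ha => ?_⟩
    obtain ⟨n, hn⟩ := ((l2Tail_tendsto (𝓕 f : L2)).eventually_lt_const ha).exists
    filter_upwards [eventually_ge_atTop (n : ℝ)] with x hx
    exact (l2Tail_antitone _ hx).trans_lt hn
  simp_rw [tailβ_eq]
  exact hsub.comp (tendsto_natCast_atTop_atTop.atTop_div_const (by positivity))

end DispersionManagement

end

theorem mainTheorem2 (ω : ℝ) (f : DispersionManagement.L2)
    (hf : DispersionManagement.IsWeakSolution ω f) :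
    (∃ s₀ : ℝ, 0 < s₀ ∧ ∀ s : ℝ, s₀ ≤ s →
      DispersionManagement.tailα f s ≤
        DispersionManagement.tailα f s₀ * (3 : ℝ) ^ (1 / 4 : ℝ) *
          (3 : ℝ) ^ (-((Real.logb 3 (s / (3 * s₀))) ^ 2 / 4))) ∧
    (∃ s₁ : ℝ, 0 < s₁ ∧ ∀ s : ℝ, s₁ ≤ s →
      DispersionManagement.tailβ f s ≤
        DispersionManagement.tailβ f s₁ * (3 : ℝ) ^ (1 / 4 : ℝ) *
          (3 : ℝ) ^ (-((Real.logb 3 (s / (3 * s₁))) ^ 2 / 4))) ∧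
    (∀ γ : ℝ, 0 < γ → ∃ C : ℝ, ∀ s : ℝ, 0 < s →
      DispersionManagement.tailα f s ≤ C * s ^ (-γ) ∧
      DispersionManagement.tailβ f s ≤ C * s ^ (-γ)) := by
  open DispersionManagement in
  obtain ⟨⟨A, hA, hrA⟩, ⟨B, hB, hrB⟩⟩ := exists_tail_recursion hf
  have hα : ∀ s, 0 ≤ tailα f s := fun s => l2Tail_nonneg _ _
  have hβ : ∀ s, 0 ≤ tailβ f s := fun s => l2Tail_nonneg _ _
  have hpi : (0:ℝ) < 2 * Real.pi := by positivity
  obtain ⟨s₀, hs₀, h₀⟩ := tail_decay_of_recursion (t := tailα f) (l2Tail_antitone f) hα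
    (l2Tail_tendsto f) hA hrA
  -- Passing from `ξ` to `k = 2πξ` multiplies `s^{-1/2}` by `(2π)^{1/2}`, which the enlarged
  -- constant absorbs.
  obtain ⟨s₁, hs₁, h₁⟩ := tail_decay_of_recursion (t := tailβ f) (tailβ_antitone f) hβ
    (tailβ_tendsto f) (C := B * (1 + (2 * Real.pi) ^ (1 / 2 : ℝ)))
    (by positivity) (by
      intro s hs
      have h := hrB (s / (2 * Real.pi)) (div_pos hs hpi)
      rw [← mul_div_assoc, ← tailβ_eq, ← tailβ_eq, Real.div_rpow hs.le hpi.le,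
        Real.rpow_neg hpi.le, div_inv_eq_mul] at h
      refine h.trans ?_
      have h2 : 0 < s ^ (-(1 / 2) : ℝ) := Real.rpow_pos_of_pos hs _
      have h3 : 0 < (2 * Real.pi) ^ (1 / 2 : ℝ) := Real.rpow_pos_of_pos hpi _
      have h4 : tailβ f s ^ 2 + s ^ (-(1 / 2) : ℝ) * (2 * Real.pi) ^ (1 / 2 : ℝ) ≤
          (1 + (2 * Real.pi) ^ (1 / 2 : ℝ)) * (tailβ f s ^ 2 + s ^ (-(1 / 2) : ℝ)) := by
        nlinarith [mul_nonneg h3.le (sq_nonneg (tailβ f s))]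
      calc _ ≤ B * tailβ f s * ((1 + (2 * Real.pi) ^ (1 / 2 : ℝ)) *
            (tailβ f s ^ 2 + s ^ (-(1 / 2) : ℝ))) :=
            mul_le_mul_of_nonneg_left h4 (mul_nonneg hB (hβ s))
        _ = _ := by ring)
  refine ⟨⟨s₀, hs₀, h₀⟩, ⟨s₁, hs₁, h₁⟩, fun γ hγ => ?_⟩
  obtain ⟨C, hC⟩ := poly_decay_of_tail (t := tailα f) (l2Tail_antitone f) hα hs₀ h₀ hγ
  obtain ⟨D, hD⟩ := poly_decay_of_tail (t := tailβ f) (tailβ_antitone f) hβ hs₁ h₁ hγ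
  refine ⟨max C D, fun s hs => ?_⟩
  have hsγ : 0 ≤ s ^ (-γ) := (Real.rpow_pos_of_pos hs _).le
  exact ⟨(hC s hs).trans (mul_le_mul_of_nonneg_right (le_max_left _ _) hsγ),
    (hD s hs).trans (mul_le_mul_of_nonneg_right (le_max_right _ _) hsγ)⟩
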